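/- Let $1 < p < \infty$, let $(a_n)_{n \in \mathbf N} \in \ell^p(\mathbf N)$ with $a_n > 0$ for all $n$, and let $M = M_p = \prod_n [0,a_n]$ be the Hilbert cube, with the metric inherited from $\ell^p(\mathbf N)$ and with the measure $\mu$ that is the product of the normalized Lebesgue measures on the factors $[0,a_n]$. All functions are real valued. Let $\mathrm{Lip}(M)$ be the algebra of (classes in $L^\infty(M)$ of) Lipschitz functions on $M$, with the norm $\|f\|_L = \max(L(f), \|f\|_\infty)$, where $L(f)$ is the Lipschitz number of $f$. On the unit ball of the dual space $\mathrm{Lip}(M)$ the weak* topology is the restriction of the weak* topology of $L^\infty(M) = L^1(M)'$. Let $\mathcal X(M)$, the module of measurable vector fields, be the $L^\infty(M)$-module of all bounded, weak*-continuous linear maps $\delta : \mathrm{Lip}(M) \to L^\infty(M)$ with $\delta(fg) = f\,\delta(g) + \delta(f)\,g$, with the operator norm and the action $(u\cdot\delta)(f) = u\,\delta(f)$. Let $l^p(L^\infty(M))$ be the $L^\infty(M)$-module of weakly $p$-summable sequences, i.e. of the sequences $g = (g_n)$ in $L^\infty(M)$ such that the partial sums $\sum_{n \le N} |g_n|^p$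 are uniformly bounded in $L^\infty(M)$, with the norm $\|g\| = \big\|(\sum_n |g_n|^p)^{1/p}\big\|_\infty$. Then for every Lipschitz function $f$ on $M$ and every $n$ the partial derivative $\partial f/\partial x_n$ exists almost everywhere and belongs to $L^\infty(M)$, and there is an isometric isomorphism of $L^\infty(M)$-modules $$l^p(L^\infty(M)) \cong \mathcal X(M), \qquad g \mapsto \delta_g, \qquad \delta_g(f) = \sum_n g_n \frac{\partial f}{\partial x_n} \quad (f \in \mathrm{Lip}(M)),$$ where the series converges unconditionally both almost everywhere and weak* in $L^\infty(M)$. -/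

import Mathlib

open MeasureTheory Filter Topology
open scoped ENNReal NNReal

noncomputable section

namespace Weaver

/-! ### Measurable vector fields on a metric measure space -/

section General

variable {M : Type*} [MeasurableSpace M]

/-- `L^∞(M, μ)`, the classes modulo equality almost everywhere of essentially bounded measurable
real functions, with the essential supremum norm. -/
abbrev Linf (μ : Measure M) := Lp ℝ ∞ μ

variable {μ : Measure M}

namespace Linf

instance instMul : Mul (Linf μ) :=
  ⟨fun f g => ⟨f.1 * g.1, Lp.mem_Lp_iff_memLp.2 <|
    (memLp_congr_ae (AEEqFun.coeFn_mul f.1 g.1)).2 (MemLp.mul (r := ∞) (Lp.memLp g) (Lp.memLp f))⟩⟩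

instance instOne : One (Linf μ) :=
  ⟨⟨1, Lp.mem_Lp_iff_memLp.2 <| (memLp_congr_ae AEEqFun.coeFn_one).2 (memLp_top_const 1)⟩⟩

theorem coeFn_mul (f g : Linf μ) : ⇑(f * g) =ᵐ[μ] fun x => f x * g x :=
  AEEqFun.coeFn_mul f.1 g.1

theorem coeFn_one : ⇑(1 : Linf μ) =ᵐ[μ] fun _ => 1 := AEEqFun.coeFn_one

theorem mul_comm' (f g : Linf μ) : f * g = g * f := Subtype.ext (mul_comm f.1 g.1)

theorem mul_add' (f g h : Linf μ) : f * (g + h) = f * g + f * h := by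
  refine Lp.ext ?_
  filter_upwards [coeFn_mul f (g + h), Lp.coeFn_add g h, Lp.coeFn_add (f * g) (f * h),
    coeFn_mul f g, coeFn_mul f h] with x h1 h2 h3 h4 h5
  rw [h1, h3, Pi.add_apply, h4, h5, h2, Pi.add_apply, mul_add]

theorem zero_mul' (f : Linf μ) : 0 * f = 0 := by
  refine Lp.ext ?_
  filter_upwards [coeFn_mul 0 f, Lp.coeFn_zero ℝ ∞ μ] with x h1 h2
  rw [h1, h2, Pi.zero_apply, zero_mul]

instance instCommRing : CommRing (Linf μ) :=
  { (inferInstance : AddCommGroup (Linf μ)) with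
    mul := (· * ·)
    one := 1
    mul_assoc := fun f g h => Subtype.ext (mul_assoc f.1 g.1 h.1)
    one_mul := fun f => Subtype.ext (one_mul f.1)
    mul_one := fun f => Subtype.ext (mul_one f.1)
    mul_comm := mul_comm'
    left_distrib := mul_add'
    right_distrib := fun f g h => by
      rw [mul_comm', mul_add', mul_comm' h, mul_comm' h]
    zero_mul := zero_mul'
    mul_zero := fun f => by rw [mul_comm', zero_mul'] }

theorem smul_mul' (r : ℝ) (f g : Linf μ) : r • f * g = r • (f * g) := by
  refine Lp.ext ?_
  filter_upwards [coeFn_mul (r • f) g, Lp.coeFn_smul r f, Lp.coeFn_smul r (f * g),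
    coeFn_mul f g] with x h1 h2 h3 h4
  rw [h1, h3, Pi.smul_apply, h4, h2, Pi.smul_apply, smul_eq_mul, smul_eq_mul, mul_assoc]

instance instAlgebra : Algebra ℝ (Linf μ) :=
  Algebra.ofModule smul_mul' fun r f g => by
    rw [mul_comm f, smul_mul', mul_comm f]

theorem coeFn_algebraMap (r : ℝ) : ⇑(algebraMap ℝ (Linf μ) r) =ᵐ[μ] fun _ => r := by
  rw [Algebra.algebraMap_eq_smul_one]
  filter_upwards [Lp.coeFn_smul r (1 : Linf μ), coeFn_one (μ := μ)] with x h1 h2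
  rw [h1, Pi.smul_apply, h2, smul_eq_mul, mul_one]

theorem ae_le_norm (f : Linf μ) : ∀ᵐ x ∂μ, ‖f x‖ ≤ ‖f‖ := by
  have h : ∀ᵐ x ∂μ, ‖f x‖ₑ ≤ eLpNormEssSup f μ := ae_le_eLpNormEssSup
  rw [← eLpNorm_exponent_top] at h
  filter_upwards [h] with x hx
  rw [Lp.norm_def, ← toReal_enorm]
  exact ENNReal.toReal_mono (Lp.memLp f).2.ne hx

theorem norm_mul_le' (f g : Linf μ) : ‖f * g‖ ≤ ‖f‖ * ‖g‖ := by
  have hn : 0 ≤ ‖f‖ * ‖g‖ := mul_nonneg (norm_nonneg _) (norm_nonneg _)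
  rw [Lp.norm_def, eLpNorm_exponent_top]
  refine ENNReal.toReal_le_of_le_ofReal hn (eLpNormEssSup_le_of_ae_bound ?_)
  filter_upwards [coeFn_mul f g, ae_le_norm f, ae_le_norm g] with x h1 h2 h3
  rw [h1, norm_mul]
  exact mul_le_mul h2 h3 (norm_nonneg _) (norm_nonneg _)

end Linf

/-- The weak* topology of `L^∞(M, μ)` as the dual of `L^1(M, μ)`. -/
@[reducible] def weakStar (μ : Measure M) : TopologicalSpace (Linf μ) :=
  TopologicalSpace.induced
    (fun f (h : Lp ℝ 1 μ) => ∫ x, f x * h x ∂μ) Pi.topologicalSpace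

theorem integrable_mul (f : Linf μ) (h : Lp ℝ 1 μ) : Integrable (fun x => f x * h x) μ :=
  memLp_one_iff_integrable.1 (MemLp.mul (r := 1) (Lp.memLp h) (Lp.memLp f))

/-! #### Weakly `p`-summable sequences -/

theorem abs_add_rpow_le (s t : ℝ) {r : ℝ} (hr : 0 ≤ r) :
    |s + t| ^ r ≤ 2 ^ r * (|s| ^ r + |t| ^ r) := by
  have h : |s + t| ≤ 2 * max |s| |t| := by
    linarith [abs_add_le s t, le_max_left |s| |t|, le_max_right |s| |t|]
  have hm : 0 ≤ max |s| |t| := (abs_nonneg s).trans (le_max_left _ _)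
  refine (Real.rpow_le_rpow (abs_nonneg _) h hr).trans ?_
  rw [Real.mul_rpow zero_le_two hm]
  refine mul_le_mul_of_nonneg_left ?_ (Real.rpow_nonneg zero_le_two _)
  have h1 := Real.rpow_nonneg (abs_nonneg s) r
  have h2 := Real.rpow_nonneg (abs_nonneg t) r
  rcases max_cases |s| |t| with ⟨e, -⟩ | ⟨e, -⟩ <;> rw [e] <;> linarith

/-- The module `l^p(L^∞(M))` of weakly `p`-summable sequences: the partial sums of
`∑ |g n| ^ p` are uniformly bounded in `L^∞(M)`. -/
def lpSeq (p : ℝ≥0) [hp : Fact (1 ≤ p)] (μ : Measure M) : Submodule (Linf μ) (ℕ → Linf μ) where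
  carrier := {g | ∃ C : ℝ, ∀ N : ℕ, ∀ᵐ x ∂μ,
    ∑ n ∈ Finset.range N, |g n x| ^ (p : ℝ) ≤ C}
  zero_mem' := by
    have hp0 : (p : ℝ) ≠ 0 := by
      have h : (1 : ℝ) ≤ p := by exact_mod_cast hp.out
      linarith
    refine ⟨0, fun N => ?_⟩
    filter_upwards [Lp.coeFn_zero ℝ ∞ μ] with x hx
    refine (Finset.sum_eq_zero fun n _ => ?_).le
    rw [Pi.zero_apply, hx, Pi.zero_apply, abs_zero, Real.zero_rpow hp0]
  add_mem' {g g'} := by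
    rintro ⟨C, h⟩ ⟨C', h'⟩
    refine ⟨2 ^ (p : ℝ) * (C + C'), fun N => ?_⟩
    have ha : ∀ᵐ x ∂μ, ∀ n, (g + g') n x = g n x + g' n x :=
      ae_all_iff.2 fun n => Lp.coeFn_add (g n) (g' n)
    filter_upwards [h N, h' N, ha] with x h1 h2 h3
    calc ∑ n ∈ Finset.range N, |(g + g') n x| ^ (p : ℝ)
        ≤ ∑ n ∈ Finset.range N,
            2 ^ (p : ℝ) * (|g n x| ^ (p : ℝ) + |g' n x| ^ (p : ℝ)) := by
          refine Finset.sum_le_sum fun n _ => ?_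
          rw [h3 n]
          exact abs_add_rpow_le _ _ p.coe_nonneg
      _ = 2 ^ (p : ℝ) * (∑ n ∈ Finset.range N, |g n x| ^ (p : ℝ) +
            ∑ n ∈ Finset.range N, |g' n x| ^ (p : ℝ)) := by
          rw [← Finset.mul_sum, Finset.sum_add_distrib]
      _ ≤ 2 ^ (p : ℝ) * (C + C') :=
          mul_le_mul_of_nonneg_left (add_le_add h1 h2) (Real.rpow_nonneg zero_le_two _)
  smul_mem' := by
    rintro u g ⟨C, h⟩
    refine ⟨‖u‖ ^ (p : ℝ) * C, fun N => ?_⟩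
    have hu : ∀ᵐ x ∂μ, ∀ n, (u • g) n x = u x * g n x :=
      ae_all_iff.2 fun n => Linf.coeFn_mul u (g n)
    filter_upwards [h N, hu, Linf.ae_le_norm u] with x h1 h2 h3
    have hb : |u x| ^ (p : ℝ) ≤ ‖u‖ ^ (p : ℝ) :=
      Real.rpow_le_rpow (abs_nonneg _) h3 p.coe_nonneg
    have hs : 0 ≤ ∑ n ∈ Finset.range N, |g n x| ^ (p : ℝ) :=
      Finset.sum_nonneg fun n _ => Real.rpow_nonneg (abs_nonneg _) _
    calc ∑ n ∈ Finset.range N, |(u • g) n x| ^ (p : ℝ)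
        = |u x| ^ (p : ℝ) * ∑ n ∈ Finset.range N, |g n x| ^ (p : ℝ) := by
          rw [Finset.mul_sum]
          refine Finset.sum_congr rfl fun n _ => ?_
          rw [h2 n, abs_mul, Real.mul_rpow (abs_nonneg _) (abs_nonneg _)]
      _ ≤ ‖u‖ ^ (p : ℝ) * C :=
          mul_le_mul hb h1 hs (Real.rpow_nonneg (norm_nonneg _) _)

/-- The norm of a weakly `p`-summable sequence `g`: the `L^∞` norm of
`|g| = (∑ |g n| ^ p) ^ (1 / p)`. -/
def seqNorm {p : ℝ≥0} [Fact (1 ≤ p)] (g : lpSeq p μ) : ℝ :=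
  (eLpNorm (fun x => (∑' n, |(g : ℕ → Linf μ) n x| ^ (p : ℝ)) ^ (1 / (p : ℝ)))
    ∞ μ).toReal

/-! #### Lipschitz functions and metric derivations -/

variable [MetricSpace M]

theorem exists_bounded_rep {f : Linf μ} {F : M → ℝ} {K : ℝ≥0} (hF : LipschitzWith K F)
    (hf : f =ᵐ[μ] F) :
    ∃ (G : M → ℝ) (L : ℝ≥0), LipschitzWith L G ∧ (∀ x, |G x| ≤ ‖f‖) ∧ f =ᵐ[μ] G := by
  refine ⟨fun x => max (-‖f‖) (min (F x) ‖f‖), K, (hF.min_const _).const_max _, fun x => ?_, ?_⟩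
  · have h := norm_nonneg f
    exact abs_le.2 ⟨le_max_left _ _, max_le (by linarith) (min_le_right _ _)⟩
  · filter_upwards [hf, Linf.ae_le_norm f] with x h1 h2
    have h3 := abs_le.1 h2
    rw [← h1, min_eq_left h3.2, max_eq_right h3.1]

/-- `Lip(M)`: the elements of `L^∞(M)` that are represented by a Lipschitz function. -/
def LipAlg (μ : Measure M) : Subalgebra ℝ (Linf μ) where
  carrier := {f | ∃ F : M → ℝ, (∃ K, LipschitzWith K F) ∧ f =ᵐ[μ] F}
  mul_mem' {f g} := by
    rintro ⟨F, ⟨K, hF⟩, hfF⟩ ⟨G, ⟨L, hG⟩, hgG⟩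
    obtain ⟨F', K', hF', hb, hf'⟩ := exists_bounded_rep hF hfF
    obtain ⟨G', L', hG', hc, hg'⟩ := exists_bounded_rep hG hgG
    refine ⟨fun x => F' x * G' x, ⟨‖f‖₊ * L' + ‖g‖₊ * K', ?_⟩, ?_⟩
    · refine LipschitzWith.of_dist_le_mul fun x y => ?_
      have h1 := hF'.dist_le_mul x y
      have h2 := hG'.dist_le_mul x y
      rw [Real.dist_eq] at h1 h2 ⊢
      have e : F' x * G' x - F' y * G' y = F' x * (G' x - G' y) + G' y * (F' x - F' y) := by ring
      rw [e]
      refine (abs_add_le _ _).trans ?_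
      rw [abs_mul, abs_mul]
      have h3 := mul_le_mul (hb x) h2 (abs_nonneg _) (norm_nonneg f)
      have h4 := mul_le_mul (hc y) h1 (abs_nonneg _) (norm_nonneg g)
      push_cast
      nlinarith
    · filter_upwards [Linf.coeFn_mul f g, hf', hg'] with x h1 h2 h3
      rw [h1, h2, h3]
  add_mem' {f g} := by
    rintro ⟨F, ⟨K, hF⟩, hfF⟩ ⟨G, ⟨L, hG⟩, hgG⟩
    refine ⟨fun x => F x + G x, ⟨K + L, hF.add hG⟩, ?_⟩
    filter_upwards [Lp.coeFn_add f g, hfF, hgG] with x h1 h2 h3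
    rw [h1, Pi.add_apply, h2, h3]
  algebraMap_mem' r := ⟨fun _ => r, ⟨0, LipschitzWith.const r⟩, Linf.coeFn_algebraMap r⟩

/-- The Lipschitz number `L(f)`: the least Lipschitz constant of a representative of `f`. -/
def lipNum (f : LipAlg μ) : ℝ :=
  sInf {K : ℝ | ∃ (F : M → ℝ) (k : ℝ≥0),
    LipschitzWith k F ∧ (f : Linf μ) =ᵐ[μ] F ∧ K = k}

/-- The norm `max (L(f), ‖f‖_∞)` of `Lip(M)`. -/
def lipNorm (f : LipAlg μ) : ℝ := max (lipNum f) ‖(f : Linf μ)‖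

/-- Weak* continuity of a linear map `Lip(M) → L^∞(M)`. On the unit ball of `Lip(M)` the weak*
topology of this dual space is the one inherited from `L^∞(M)`, and a linear map out of a dual
Banach space is weak* continuous as soon as its restriction to the unit ball is. -/
def WeakStarContinuous (δ : LipAlg μ → Linf μ) : Prop :=
  @ContinuousOn (LipAlg μ) (Linf μ)
    (TopologicalSpace.induced (fun f : LipAlg μ => (f : Linf μ)) (weakStar μ)) (weakStar μ)
    δ {f | lipNorm f ≤ 1}

theorem weakStarContinuous_iff (δ : LipAlg μ → Linf μ) :
    WeakStarContinuous δ ↔ ∀ h : Lp ℝ 1 μ,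
      @ContinuousOn (LipAlg μ) ℝ
        (TopologicalSpace.induced (fun f : LipAlg μ => (f : Linf μ)) (weakStar μ)) _
        (fun f => ∫ x, δ f x * h x ∂μ) {f | lipNorm f ≤ 1} := by
  let _ : TopologicalSpace (LipAlg μ) :=
    TopologicalSpace.induced (fun f : LipAlg μ => (f : Linf μ)) (weakStar μ)
  let _ : TopologicalSpace (Linf μ) := weakStar μ
  have h : Topology.IsInducing (fun (f : Linf μ) (h : Lp ℝ 1 μ) => ∫ x, f x * h x ∂μ) := ⟨rfl⟩
  exact h.continuousOn_iff.trans continuousOn_pi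

/-- The module `𝒳(M)` of measurable vector fields: the bounded weak* continuous derivations
`Lip(M) → L^∞(M)`, with `(u • δ) f = u * δ f` for `u ∈ L^∞(M)`. -/
def VectorField (μ : Measure M) : Submodule (Linf μ) (Derivation ℝ (LipAlg μ) (Linf μ)) where
  carrier := {δ | (∃ C : ℝ, ∀ f, ‖δ f‖ ≤ C * lipNorm f) ∧ WeakStarContinuous δ}
  zero_mem' := by
    refine ⟨⟨0, fun f => by simp⟩, (weakStarContinuous_iff _).2 fun h => ?_⟩
    let _ : TopologicalSpace (LipAlg μ) :=
      TopologicalSpace.induced (fun f : LipAlg μ => (f : Linf μ)) (weakStar μ)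
    exact continuousOn_const (c := ∫ x, (0 : Linf μ) x * h x ∂μ)
  add_mem' {δ δ'} := by
    rintro ⟨⟨C, h⟩, hc⟩ ⟨⟨C', h'⟩, hc'⟩
    refine ⟨⟨C + C', fun f => ?_⟩, (weakStarContinuous_iff _).2 fun k => ?_⟩
    · rw [Derivation.add_apply, add_mul]
      exact (norm_add_le _ _).trans (add_le_add (h f) (h' f))
    · have e : (fun f => ∫ x, (δ + δ') f x * k x ∂μ) =
          fun f => ∫ x, δ f x * k x ∂μ + ∫ x, δ' f x * k x ∂μ := by
        funext f
        rw [← integral_add (integrable_mul _ _) (integrable_mul _ _)]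
        refine integral_congr_ae ?_
        filter_upwards [Lp.coeFn_add (δ f) (δ' f)] with x hx
        rw [Derivation.add_apply, hx, Pi.add_apply, add_mul]
      rw [e]
      exact @ContinuousOn.add _ _ _ _ _ (_) _ _ _
        ((weakStarContinuous_iff _).1 hc k) ((weakStarContinuous_iff _).1 hc' k)
  smul_mem' u δ := by
    rintro ⟨⟨C, h⟩, hc⟩
    refine ⟨⟨‖u‖ * C, fun f => ?_⟩, (weakStarContinuous_iff _).2 fun k => ?_⟩
    · rw [Derivation.smul_apply, smul_eq_mul, mul_assoc]
      exact (Linf.norm_mul_le' _ _).trans (mul_le_mul_of_nonneg_left (h f) (norm_nonneg _))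
    · have hk : MemLp (fun x => u x * k x) 1 μ :=
        memLp_one_iff_integrable.2 (integrable_mul u k)
      have e : (fun f => ∫ x, (u • δ) f x * k x ∂μ) =
          fun f => ∫ x, δ f x * hk.toLp _ x ∂μ := by
        funext f
        refine integral_congr_ae ?_
        filter_upwards [Linf.coeFn_mul u (δ f), hk.coeFn_toLp] with x h1 h2
        rw [Derivation.smul_apply, smul_eq_mul, h1, h2]
        ring
      rw [e]
      exact (weakStarContinuous_iff _).1 hc _

/-- The operator norm of a metric derivation `Lip(M) → L^∞(M)`. -/
def vfNorm (δ : VectorField μ) : ℝ :=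
  sInf {C : ℝ | 0 ≤ C ∧
    ∀ f, ‖(δ : Derivation ℝ (LipAlg μ) (Linf μ)) f‖ ≤ C * lipNorm f}

end General

/-! ### The Hilbert cube -/

section Cube

/-- For `1 ≤ p < ∞` the `l^p` norm on sequences is available. -/
instance fact_one_le_coe {p : ℝ≥0} [hp : Fact (1 ≤ p)] : Fact ((1 : ℝ≥0∞) ≤ p) :=
  ⟨by exact_mod_cast hp.out⟩

variable {p : ℝ≥0} [hp : Fact (1 ≤ p)]

/-- The Hilbert cube `M_p = ∏ [0, a n]`, a subset of `l^p(ℕ)` with the `l^p` metric. -/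
def HilbertCube (a : lp (fun _ : ℕ => ℝ) p) : Type :=
  {x : lp (fun _ : ℕ => ℝ) p // ∀ n, x n ∈ Set.Icc 0 (a n)}

namespace HilbertCube

theorem pos_toReal : 0 < (p : ℝ≥0∞).toReal :=
  ENNReal.toReal_pos (zero_lt_one.trans_le fact_one_le_coe.out).ne' ENNReal.coe_ne_top

variable {a : lp (fun _ : ℕ => ℝ) p}

instance : MetricSpace (HilbertCube a) :=
  inferInstanceAs (MetricSpace {x : lp (fun _ : ℕ => ℝ) p // ∀ n, x n ∈ Set.Icc 0 (a n)})

instance : MeasurableSpace (HilbertCube a) := borel _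

instance : BorelSpace (HilbertCube a) := ⟨rfl⟩

/-- The `n`-th coordinate of a point of the cube. -/
def coord (x : HilbertCube a) (n : ℕ) : Set.Icc (0 : ℝ) (a n) := ⟨x.1 n, x.2 n⟩

/-- Every sequence in `∏ [0, a n]` is a point of the cube. -/
def ofPi (x : (n : ℕ) → Set.Icc (0 : ℝ) (a n)) : HilbertCube a :=
  ⟨⟨fun n => x n, memℓp_gen <| by
    refine ((lp.memℓp a).summable (pos_toReal (p := p))).of_nonneg_of_le
      (fun n => Real.rpow_nonneg (norm_nonneg _) _) fun n => ?_
    refine Real.rpow_le_rpow (norm_nonneg _) ?_ ENNReal.toReal_nonneg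
    rw [Real.norm_of_nonneg (x n).2.1]
    exact (x n).2.2.trans (le_abs_self _)⟩, fun n => (x n).2⟩

theorem continuous_ofPi : Continuous (ofPi (a := a)) := by
  have hp0 := pos_toReal (p := p)
  have hs := (lp.memℓp a).summable hp0
  refine continuous_iff_continuousAt.2 fun x => tendsto_iff_dist_tendsto_zero.2 ?_
  have hd : ∀ y, dist (ofPi (a := a) y) (ofPi x) =
      (∑' n, |(y n : ℝ) - x n| ^ (p : ℝ≥0∞).toReal) ^ (1 / (p : ℝ≥0∞).toReal) := by
    intro y
    change dist (ofPi (a := a) y).1 (ofPi x).1 = _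
    rw [dist_eq_norm, lp.norm_eq_tsum_rpow hp0]
    rfl
  have hc : Continuous fun y : (n : ℕ) → Set.Icc (0 : ℝ) (a n) =>
      ∑' n, |(y n : ℝ) - x n| ^ (p : ℝ≥0∞).toReal := by
    refine continuous_tsum (fun n => ?_) hs fun n y => ?_
    · exact Continuous.rpow_const (by fun_prop) fun _ => Or.inr hp0.le
    · rw [Real.norm_of_nonneg (Real.rpow_nonneg (abs_nonneg _) _)]
      refine Real.rpow_le_rpow (abs_nonneg _) ?_ hp0.le
      refine le_trans ?_ (le_abs_self _)
      have h1 := (y n).2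
      have h2 := (x n).2
      exact abs_le.2 ⟨by linarith [h1.1, h2.2], by linarith [h1.2, h2.1]⟩
  have ht := (hc.rpow_const (p := 1 / (p : ℝ≥0∞).toReal)
    fun _ => Or.inr (by positivity)).tendsto x
  simp only [sub_self, abs_zero, Real.zero_rpow hp0.ne', tsum_zero,
    Real.zero_rpow (one_div_pos.2 hp0).ne'] at ht
  simpa only [hd] using ht

/-- The product of the normalized Lebesgue measures on the factors `[0, a n]`. -/
def measure (a : lp (fun _ : ℕ => ℝ) p) : Measure (HilbertCube a) :=
  (Measure.infinitePi fun n =>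
    (ENNReal.ofReal (a n))⁻¹ • Measure.comap (Subtype.val : Set.Icc (0 : ℝ) (a n) → ℝ) volume).map ofPi

/-- The restriction of `F` to the line through `x` in the `n`-th coordinate direction, as a
function of the `n`-th coordinate `t ∈ [0, a n]` (and extended by constants to all real `t`). -/
def slice (F : HilbertCube a → ℝ) (n : ℕ) (x : HilbertCube a) : ℝ → ℝ :=
  Set.IccExtend ((x.2 n).1.trans (x.2 n).2)
    fun t : Set.Icc (0 : ℝ) (a n) => F (ofPi (Function.update x.coord n t))

/-- The partial derivative `∂F/∂x_n` at `x`. -/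
def partialDeriv (F : HilbertCube a → ℝ) (n : ℕ) (x : HilbertCube a) : ℝ :=
  derivWithin (slice F n x) (Set.Icc 0 (a n)) (x.coord n)

end HilbertCube

end Cube

end Weaver

end

noncomputable section

set_option linter.unusedSectionVars false

namespace Weaver

/-! ### Resampling finitely many coordinates of a product measure -/

/-! The analytic core is that almost everywhere the gradient of a Lipschitz function lies in the
ball of radius `L(f)` of the dual of `l^p` (`ae_gradient`). Freezing all but finitely many
coordinates gives a Lipschitz function on `ℝ^S`; Rademacher's theorem applies to it, its difference
quotients are controlled by the `l^p` metric, and Fubini removes the freezing. Hence `∑ g_n ∂f/∂x_n`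
converges absolutely almost everywhere, with `|δ_g f| ≤ L(f) |g|`.

Weak* continuity of `δ_g`: integration by parts against Lipschitz functions vanishing on two
opposite faces, which are dense in `L^1`, handles each `∂/∂x_n` (`continuousOn_integral_pderiv`);
the tail of the series is small in the weak sense, uniformly on the unit ball
(`weakStarContinuous_combo`).

Isometry: `δ_g` sends the coordinate `x_n` to `g_n`. A derivation bounded by `C` for the norm `max
(L(f), ‖f‖_∞)` is already bounded by `C · L(f)` (`norm_le_mul_lipNum`), because composing with a
bounded function of derivative `1` at a given value shrinks the sup norm without changing `δ f`
where `f` takes that value. Applied to linear functions `∑ c_n x_n`, whose Lipschitz number is at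
most the `l^q` norm of `c`, this gives `∑ |δ x_n| ^ p ≤ C ^ p` almost everywhere by duality.

Surjectivity: subtracting from `δ` the field with coefficients `δ x_n` leaves a field that
annihilates the coordinates, and such a field is zero (`vectorField_eq_zero`). Its kernel is closed
under linear combinations, absolute values, minima and pointwise limits with a common Lipschitz
constant, and these operations produce every Lipschitz function from the coordinates. -/

theorem measurable_finsetPiecewise {ι : Type*} [DecidableEq ι] {X : ι → Type*}
    [∀ i, MeasurableSpace (X i)] (S : Finset ι) :
    Measurable fun z : (∀ i, X i) × (∀ i, X i) => S.piecewise z.2 z.1 := by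
  refine measurable_pi_lambda _ fun i => ?_
  by_cases hi : i ∈ S
  · simp only [Finset.piecewise, hi, if_true]
    fun_prop
  · simp only [Finset.piecewise, hi, if_false]
    fun_prop

/-- The preimage of a box is a box in the coordinates outside `S` for one copy times a box in the
coordinates of `S` for the other, and the two masses multiply to that of the original box. This
turns Fubini in finitely many directions into a statement about two independent copies of the
product. -/
theorem measurePreserving_finsetPiecewise {ι : Type*} [DecidableEq ι] {X : ι → Type*}
    [∀ i, MeasurableSpace (X i)] (ν : ∀ i, Measure (X i)) [∀ i, IsProbabilityMeasure (ν i)]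
    (S : Finset ι) :
    MeasurePreserving (fun z : (∀ i, X i) × (∀ i, X i) => S.piecewise z.2 z.1)
      ((Measure.infinitePi ν).prod (Measure.infinitePi ν)) (Measure.infinitePi ν) := by
  refine ⟨measurable_finsetPiecewise S, Measure.eq_infinitePi ν fun s t ht => ?_⟩
  rw [Measure.map_apply (measurable_finsetPiecewise S)
    (MeasurableSet.pi s.countable_toSet fun i _ => ht i)]
  have e : (fun z : (∀ i, X i) × (∀ i, X i) => S.piecewise z.2 z.1) ⁻¹' Set.pi s t =
      (Set.pi (s \ S : Finset ι) t) ×ˢ (Set.pi (s ∩ S : Finset ι) t) := by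
    ext z
    simp only [Set.mem_preimage, Set.mem_pi, Set.mem_prod, Finset.mem_coe, Finset.mem_sdiff,
      Finset.mem_inter, Finset.piecewise]
    constructor
    · intro h
      exact ⟨fun i hi => by simpa [hi.2] using h i hi.1,
        fun i hi => by simpa [hi.2] using h i hi.1⟩
    · rintro ⟨h1, h2⟩ i hi
      by_cases hS : i ∈ S
      · simpa [hS] using h2 i ⟨hi, hS⟩
      · simpa [hS] using h1 i ⟨hi, hS⟩
  rw [e, Measure.prod_prod, Measure.infinitePi_pi _ fun i _ => ht i,
    Measure.infinitePi_pi _ fun i _ => ht i, mul_comm,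
    Finset.prod_inter_mul_prod_sdiff]

/-- The uniform probability on a box of `ℝ^S` is absolutely continuous. -/
theorem pi_uniform_absolutelyContinuous {ι : Type*} [Fintype ι] (c : ι → ℝ≥0∞)
    (hc : ∀ i, c i ≠ ∞) (s : ι → Set ℝ) :
    Measure.pi (fun i => c i • volume.restrict (s i)) ≪ (volume : Measure (ι → ℝ)) := by
  have : ∀ i, SigmaFinite (c i • (volume : Measure ℝ).restrict (s i)) := fun i =>
    ENNReal.coe_toNNReal (hc i) ▸ SMul.sigmaFinite (μ := volume.restrict (s i)) (c i).toNNReal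
  have h : Measure.pi (fun i => c i • volume.restrict (s i)) =
      (∏ i, c i) • (volume : Measure (ι → ℝ)).restrict (Set.univ.pi s) := by
    rw [volume_pi, Measure.restrict_pi_pi]
    refine Measure.pi_eq fun t ht => ?_
    rw [Measure.smul_apply, Measure.pi_pi]
    simp [Finset.prod_mul_distrib]
  rw [h]
  exact Measure.smul_absolutelyContinuous.trans Measure.absolutelyContinuous_restrict

namespace HilbertCube

variable {p : ℝ≥0} [hp : Fact (1 ≤ p)] {a : lp (fun _ : ℕ => ℝ) p}

/-! ### The topology of the cube -/

@[simp] theorem coord_ofPi (x : (n : ℕ) → Set.Icc (0 : ℝ) (a n)) : (ofPi x).coord = x := rfl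

@[simp] theorem ofPi_coord (x : HilbertCube a) : ofPi x.coord = x := rfl

@[simp] theorem coe_coord (x : HilbertCube a) (n : ℕ) : (x.coord n : ℝ) = x.1 n := rfl

theorem one_le_coe : (1 : ℝ) ≤ p := by exact_mod_cast hp.out

theorem coe_pos : (0 : ℝ) < p := zero_lt_one.trans_le (one_le_coe)

theorem dist_def (x y : HilbertCube a) : dist x y = ‖x.1 - y.1‖ := by
  rw [← dist_eq_norm]
  rfl

theorem abs_sub_le_dist (x y : HilbertCube a) (n : ℕ) : |x.1 n - y.1 n| ≤ dist x y := by
  rw [dist_def]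
  exact lp.norm_apply_le_norm (zero_lt_one.trans_le fact_one_le_coe.out).ne' (x.1 - y.1) n

theorem dist_eq_tsum (x y : HilbertCube a) :
    dist x y = (∑' n, |x.1 n - y.1 n| ^ (p : ℝ)) ^ (1 / (p : ℝ)) := by
  rw [dist_def, lp.norm_eq_tsum_rpow pos_toReal]
  rfl

theorem summable_abs_sub_rpow (x y : HilbertCube a) :
    Summable fun n => |x.1 n - y.1 n| ^ (p : ℝ) :=
  (lp.memℓp (x.1 - y.1)).summable pos_toReal

theorem dist_eq_sum {x y : HilbertCube a} {S : Finset ℕ} (h : ∀ n ∉ S, x.1 n = y.1 n) :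
    dist x y = (∑ n ∈ S, |x.1 n - y.1 n| ^ (p : ℝ)) ^ (1 / (p : ℝ)) := by
  rw [dist_eq_tsum, tsum_eq_sum fun n hn => ?_]
  rw [h n hn, sub_self, abs_zero, Real.zero_rpow coe_pos.ne']

theorem sum_rpow_le_dist (x y : HilbertCube a) (S : Finset ℕ) :
    (∑ n ∈ S, |x.1 n - y.1 n| ^ (p : ℝ)) ^ (1 / (p : ℝ)) ≤ dist x y := by
  rw [dist_eq_tsum]
  refine Real.rpow_le_rpow (Finset.sum_nonneg fun n _ => by positivity)
    ((summable_abs_sub_rpow x y).sum_le_tsum S fun n _ => by positivity) (by positivity)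

theorem continuous_apply (n : ℕ) : Continuous fun x : HilbertCube a => x.1 n :=
  (LipschitzWith.of_dist_le_mul (K := 1) fun x y => by
    simpa [Real.dist_eq] using abs_sub_le_dist x y n).continuous

@[fun_prop] theorem continuous_coord_apply (n : ℕ) :
    Continuous fun x : HilbertCube a => x.coord n :=
  Continuous.subtype_mk (continuous_apply n) _

@[fun_prop] theorem continuous_coord : Continuous (coord (a := a)) :=
  continuous_pi continuous_coord_apply

instance : CompactSpace (HilbertCube a) :=
  Function.Surjective.compactSpace continuous_ofPi fun x => ⟨x.coord, rfl⟩

theorem measurable_ofPi : Measurable (ofPi (a := a)) := continuous_ofPi.measurable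

theorem measurable_coord : Measurable (coord (a := a)) := continuous_coord.measurable

/-! ### The product measure -/

/-- The normalized Lebesgue measure on `[0, a n]`. -/
abbrev factor (a : lp (fun _ : ℕ => ℝ) p) (n : ℕ) : Measure (Set.Icc (0 : ℝ) (a n)) :=
  (ENNReal.ofReal (a n))⁻¹ • Measure.comap (Subtype.val : Set.Icc (0 : ℝ) (a n) → ℝ) volume

theorem map_val_factor (a : lp (fun _ : ℕ => ℝ) p) (n : ℕ) :
    (factor a n).map Subtype.val =
      (ENNReal.ofReal (a n))⁻¹ • volume.restrict (Set.Icc 0 (a n)) := by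
  rw [factor, Measure.map_smul, map_comap_subtype_coe measurableSet_Icc]

variable [ha : Fact (∀ n, 0 < a n)]

instance isProbabilityMeasure_factor (n : ℕ) : IsProbabilityMeasure (factor a n) := by
  refine ⟨?_⟩
  have h : factor a n Set.univ = (factor a n).map Subtype.val Set.univ := by
    rw [Measure.map_apply measurable_subtype_coe MeasurableSet.univ, Set.preimage_univ]
  rw [h, map_val_factor]
  simp only [Measure.smul_apply, MeasurableSet.univ, Measure.restrict_apply, Set.univ_inter,
    Real.volume_Icc, sub_zero, smul_eq_mul]
  exact ENNReal.inv_mul_cancel (ENNReal.ofReal_pos.2 (ha.out n)).ne' ENNReal.ofReal_ne_top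

instance isProbabilityMeasure_measure : IsProbabilityMeasure (measure a) :=
  Measure.isProbabilityMeasure_map measurable_ofPi.aemeasurable

theorem measurePreserving_ofPi :
    MeasurePreserving (ofPi (a := a)) (Measure.infinitePi (factor a)) (measure a) :=
  ⟨measurable_ofPi, rfl⟩

theorem measurePreserving_coord :
    MeasurePreserving (coord (a := a)) (measure a) (Measure.infinitePi (factor a)) := by
  refine ⟨measurable_coord, ?_⟩
  rw [measure, Measure.map_map measurable_coord measurable_ofPi]
  exact Measure.map_id

/-- The point with the coordinates of `y` in the directions of `S` and those of `x` in the
others. -/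
def patch (S : Finset ℕ) (x y : HilbertCube a) : HilbertCube a :=
  ofPi (S.piecewise y.coord x.coord)

theorem measurePreserving_patch (S : Finset ℕ) :
    MeasurePreserving (fun z : HilbertCube a × HilbertCube a => patch S z.1 z.2)
      ((measure a).prod (measure a)) (measure a) :=
  (measurePreserving_ofPi.comp (measurePreserving_finsetPiecewise (factor a) S)).comp
    (measurePreserving_coord.prod measurePreserving_coord)

/-- Fubini for the two copies: `x` is frozen outside `S`, and only the coordinates of `y` in `S`
matter. -/
theorem ae_of_forall_ae_patch (S : Finset ℕ) {B : Set (HilbertCube a)} (hB : MeasurableSet B)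
    (h : ∀ x, ∀ᵐ y ∂measure a, patch S x y ∈ B) : ∀ᵐ x ∂measure a, x ∈ B := by
  have h1 : ∀ᵐ z ∂(measure a).prod (measure a), patch S z.1 z.2 ∈ B :=
    (Measure.ae_prod_iff_ae_ae ((measurePreserving_patch S).measurable hB)).2
      (Eventually.of_forall h)
  rw [← (measurePreserving_patch S).map_eq]
  exact (ae_map_iff (measurePreserving_patch S).measurable.aemeasurable hB).2 h1

/-- The law of finitely many coordinates is absolutely continuous. -/
theorem map_restrict_absolutelyContinuous (S : Finset ℕ) :
    (measure a).map (fun y (n : S) => y.1 n) ≪ (volume : Measure (S → ℝ)) := by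
  have e : (fun (y : HilbertCube a) (n : S) => y.1 n) =
      (fun (t : (n : S) → Set.Icc (0 : ℝ) (a n)) (n : S) => (t n : ℝ)) ∘
        (S.restrict ∘ coord) := rfl
  have hm : Measurable fun (t : (n : S) → Set.Icc (0 : ℝ) (a n)) (n : S) => (t n : ℝ) := by
    fun_prop
  have hr : Measurable (S.restrict : ((n : ℕ) → Set.Icc (0 : ℝ) (a n)) → _) := by
    fun_prop
  have hprob (n : ℕ) : IsProbabilityMeasure ((factor a n).map Subtype.val) :=
    Measure.isProbabilityMeasure_map measurable_subtype_coe.aemeasurable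
  have hpi : (Measure.pi fun n : S => factor a n).map (fun t (n : S) => (t n : ℝ)) =
      Measure.pi fun n : S => (factor a n).map Subtype.val :=
    Measure.pi_map_pi (μ := fun n : S => factor a n) (hμ := fun n => by
      have := hprob n; infer_instance) fun _ => measurable_subtype_coe.aemeasurable
  rw [e, ← Measure.map_map hm (hr.comp measurable_coord),
    ← Measure.map_map hr measurable_coord, measurePreserving_coord.map_eq,
    Measure.infinitePi_map_restrict, hpi]
  simp only [map_val_factor]
  exact pi_uniform_absolutelyContinuous (ι := S) _
    (fun n => ENNReal.inv_ne_top.2 (ENNReal.ofReal_pos.2 (ha.out n)).ne') _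

/-- Transports the exceptional null set of Rademacher's theorem from `ℝ^S` to the cube. -/
theorem ae_restrict_of_ae (S : Finset ℕ) {P : (S → ℝ) → Prop} (h : ∀ᵐ t, P t) :
    ∀ᵐ y ∂measure a, P fun n : S => y.1 n := by
  have hm : Measurable fun (y : HilbertCube a) (n : S) => y.1 n :=
    measurable_pi_lambda _ fun n => (continuous_apply _).measurable
  exact ae_of_ae_map hm.aemeasurable ((map_restrict_absolutelyContinuous S).ae_le h)

theorem map_apply_measure (n : ℕ) : (measure a).map (fun x => x.1 n) =
    (ENNReal.ofReal (a n))⁻¹ • volume.restrict (Set.Icc 0 (a n)) := by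
  have e : (fun x : HilbertCube a => x.1 n) = Subtype.val ∘ ((fun x => x n) ∘ coord) := rfl
  rw [e, ← Measure.map_map measurable_subtype_coe ((measurable_pi_apply n).comp measurable_coord),
    ← Measure.map_map (measurable_pi_apply n) measurable_coord, measurePreserving_coord.map_eq,
    Measure.infinitePi_map_eval, map_val_factor]

/-- The faces are null, so derivatives within `[0, a n]` may be treated as ordinary two-sided
derivatives. -/
theorem ae_mem_Ioo : ∀ᵐ x ∂measure a, ∀ n, x.1 n ∈ Set.Ioo 0 (a n) := by
  refine ae_all_iff.2 fun n => ?_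
  refine ae_of_ae_map (p := fun t => t ∈ Set.Ioo 0 (a n)) (continuous_apply n).aemeasurable ?_
  rw [map_apply_measure]
  refine Measure.ae_smul_measure ?_ _
  rw [restrict_Ioo_eq_restrict_Icc.symm]
  exact ae_restrict_mem measurableSet_Ioo

/-! ### Rademacher's theorem on the cube -/

/-- The point with the coordinates `t n`, cut off to `[0, a n]`, in the directions of `S` and those
of `x` in the others. -/
def fill (S : Finset ℕ) (x : HilbertCube a) (t : S → ℝ) : HilbertCube a :=
  ofPi fun n => if h : n ∈ S then Set.projIcc 0 (a n) (ha.out n).le (t ⟨n, h⟩) else x.coord n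

theorem patch_eq_fill (S : Finset ℕ) (x y : HilbertCube a) :
    patch S x y = fill S x fun n => y.1 n := by
  refine congrArg ofPi (funext fun n => ?_)
  by_cases h : n ∈ S
  · simp only [Finset.piecewise, h, if_true, dif_pos]
    exact (Set.projIcc_val (ha.out n).le (y.coord n)).symm
  · simp [Finset.piecewise, h]

theorem fill_apply_of_mem {S : Finset ℕ} {x : HilbertCube a} {t : S → ℝ} (n : S)
    (h : t n ∈ Set.Icc 0 (a n)) : (fill S x t).1 n = t n := by
  change ((fill S x t).coord n : ℝ) = t n
  simp only [fill, coord_ofPi, n.2, dif_pos]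
  rw [Set.projIcc_of_mem _ h]

theorem dist_fill_le (S : Finset ℕ) (x : HilbertCube a) (t t' : S → ℝ) :
    dist (fill S x t) (fill S x t') ≤ (∑ n, |t n - t' n| ^ (p : ℝ)) ^ (1 / (p : ℝ)) := by
  rw [dist_eq_sum (S := S), ← Finset.sum_coe_sort]
  · have := coe_pos (p := p)
    refine Real.rpow_le_rpow (by positivity) (Finset.sum_le_sum fun n _ => ?_) (by positivity)
    refine Real.rpow_le_rpow (abs_nonneg _) ?_ this.le
    change |((fill S x t).coord n : ℝ) - (fill S x t').coord n| ≤ _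
    simp only [fill, coord_ofPi, n.2, dif_pos]
    exact Set.abs_projIcc_sub_projIcc _
  · intro n hn
    change ((fill S x t).coord n : ℝ) = (fill S x t').coord n
    simp [fill, hn]

/-- `S → ℝ` carries the sup metric, which costs a factor `card ^ (1 / p)`. The constant is
irrelevant: it only makes Rademacher's theorem applicable, while the sharp estimate is
`dist_fill_le`. -/
theorem exists_lipschitzWith_fill (S : Finset ℕ) (x : HilbertCube a) :
    ∃ C, LipschitzWith C (fill S x) := by
  have hp0 := coe_pos (p := p)
  refine ⟨⟨(S.card : ℝ) ^ (1 / (p : ℝ)), by positivity⟩, LipschitzWith.of_dist_le_mul fun t t' => ?_⟩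
  refine (dist_fill_le S x t t').trans ?_
  have h : ∑ n, |t n - t' n| ^ (p : ℝ) ≤ S.card * dist t t' ^ (p : ℝ) := by
    refine (Finset.sum_le_card_nsmul _ _ (dist t t' ^ (p : ℝ)) fun n _ => ?_).trans_eq (by simp)
    exact Real.rpow_le_rpow (abs_nonneg _) (dist_le_pi_dist t t' n) hp0.le
  refine (Real.rpow_le_rpow (by positivity) h (by positivity)).trans_eq ?_
  rw [Real.mul_rpow (by positivity) (by positivity), ← Real.rpow_mul dist_nonneg,
    mul_one_div_cancel hp0.ne', Real.rpow_one]
  rfl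

theorem slice_apply (F : HilbertCube a → ℝ) (n : ℕ) (x : HilbertCube a) (s : ℝ) :
    slice F n x s =
      F (ofPi (Function.update x.coord n (Set.projIcc 0 (a n) (ha.out n).le s))) := rfl

theorem slice_fill {S : Finset ℕ} (F : HilbertCube a → ℝ) (x : HilbertCube a) (t : S → ℝ) (n : S)
    (s : ℝ) : slice F n (fill S x t) s = F (fill S x (Function.update t n s)) := by
  rw [slice_apply]
  refine congrArg F (congrArg ofPi (funext fun m => ?_))
  by_cases hm : m = n
  · subst hm
    simp
  · rw [Function.update_of_ne hm]
    simp only [fill, coord_ofPi]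
    by_cases h : m ∈ S
    · have : (⟨m, h⟩ : S) ≠ n := fun e => hm (congrArg Subtype.val e)
      simp [h, Function.update_of_ne this]
    · simp [h]

theorem slice_self (F : HilbertCube a → ℝ) (n : ℕ) (x : HilbertCube a) :
    slice F n x (x.1 n) = F x := by
  rw [slice_apply]
  have h : Set.projIcc 0 (a n) (ha.out n).le (x.1 n) = x.coord n :=
    Set.projIcc_val (ha.out n).le (x.coord n)
  rw [h, Function.update_eq_self, ofPi_coord]

theorem hasDerivAt_slice_fill {S : Finset ℕ} {F : HilbertCube a → ℝ} {x : HilbertCube a}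
    {t : S → ℝ} (h : DifferentiableAt ℝ (fun t => F (fill S x t)) t) (n : S) :
    HasDerivAt (slice F n (fill S x t))
      (fderiv ℝ (fun t => F (fill S x t)) t (Pi.single n 1)) (t n) := by
  have e : slice F n (fill S x t) = (fun t => F (fill S x t)) ∘ Function.update t n :=
    funext fun s => slice_fill F x t n s
  rw [e]
  refine HasFDerivAt.comp_hasDerivAt (t n) ?_ (hasDerivAt_update t n (t n))
  rw [Function.update_eq_self]
  exact h.hasFDerivAt

/-- The difference quotient along `c` is measured with the `l^p` distance on the cube, not with the
sup metric of the parameter space; this produces the sharp dual norm. -/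
theorem abs_fderiv_fill_le {S : Finset ℕ} {F : HilbertCube a → ℝ} {K : ℝ≥0}
    (hF : LipschitzWith K F) {x : HilbertCube a} {t : S → ℝ}
    (h : DifferentiableAt ℝ (fun t => F (fill S x t)) t) (c : S → ℝ) :
    |fderiv ℝ (fun t => F (fill S x t)) t c| ≤
      K * (∑ n, |c n| ^ (p : ℝ)) ^ (1 / (p : ℝ)) := by
  have hp0 := coe_pos (p := p)
  have hd : HasDerivAt (fun s : ℝ => F (fill S x (t + s • c)))
      (fderiv ℝ (fun t => F (fill S x t)) t c) 0 := h.hasFDerivAt.hasLineDerivAt c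
  refine hd.le_of_lip' (by positivity) (Eventually.of_forall fun s => ?_)
  have h1 := hF.dist_le_mul (fill S x (t + s • c)) (fill S x (t + (0 : ℝ) • c))
  rw [Real.dist_eq] at h1
  refine h1.trans ?_
  rw [mul_assoc]
  refine mul_le_mul_of_nonneg_left ((dist_fill_le _ _ _ _).trans_eq ?_) K.2
  have h2 : ∀ n : S, |(t + s • c) n - (t + (0 : ℝ) • c) n| ^ (p : ℝ) =
      |s| ^ (p : ℝ) * |c n| ^ (p : ℝ) := fun n => by
    rw [← Real.mul_rpow (abs_nonneg _) (abs_nonneg _), ← abs_mul]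
    simp
  simp only [h2]
  rw [← Finset.mul_sum, Real.mul_rpow (by positivity) (by positivity),
    ← Real.rpow_mul (abs_nonneg _), mul_one_div_cancel hp0.ne', Real.rpow_one, mul_comm]
  simp

theorem continuous_uncurry_slice {F : HilbertCube a → ℝ} (hF : Continuous F) (n : ℕ) :
    Continuous (Function.uncurry fun x => slice F n x) := by
  have e : (Function.uncurry fun x => slice F n x) = fun z : HilbertCube a × ℝ =>
      F (ofPi (Function.update z.1.coord n (Set.projIcc 0 (a n) (ha.out n).le z.2))) := rfl
  rw [e]
  refine hF.comp (continuous_ofPi.comp (Continuous.update ?_ n ?_))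
  · exact continuous_coord.comp continuous_fst
  · exact continuous_projIcc.comp continuous_snd

theorem measurable_deriv_slice {F : HilbertCube a → ℝ} (hF : Continuous F) (n : ℕ) :
    Measurable fun x : HilbertCube a => deriv (slice F n x) (x.1 n) :=
  (measurable_deriv_with_param (continuous_uncurry_slice hF n)).comp
    (measurable_id.prodMk (continuous_apply n).measurable)

theorem measurableSet_differentiableAt_slice {F : HilbertCube a → ℝ} (hF : Continuous F) (n : ℕ) :
    MeasurableSet {x : HilbertCube a | DifferentiableAt ℝ (slice F n x) (x.1 n)} :=
  (measurable_id.prodMk (continuous_apply n).measurable)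
    (measurableSet_of_differentiableAt_with_param ℝ (continuous_uncurry_slice hF n))

theorem partialDeriv_eq_deriv (F : HilbertCube a → ℝ) {n : ℕ} {x : HilbertCube a}
    (hx : x.1 n ∈ Set.Ioo 0 (a n)) : partialDeriv F n x = deriv (slice F n x) (x.1 n) :=
  derivWithin_of_mem_nhds (Icc_mem_nhds hx.1 hx.2)

/-- Rademacher's theorem is applied to `F ∘ fill S x` for each frozen `x`, followed by
`ae_of_forall_ae_patch`. That step needs a measurable set, so the inequality is first required only
for a dense sequence of vectors `c`; both sides are continuous in `c`. -/
theorem ae_gradient_finset {F : HilbertCube a → ℝ} {K : ℝ≥0} (hF : LipschitzWith K F)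
    (S : Finset ℕ) : ∀ᵐ x ∂measure a, (∀ n ∈ S, DifferentiableAt ℝ (slice F n x) (x.1 n)) ∧
      ∀ c : S → ℝ, |∑ n : S, c n * deriv (slice F n x) (x.1 n)| ≤
        K * (∑ n, |c n| ^ (p : ℝ)) ^ (1 / (p : ℝ)) := by
  have hp0 := coe_pos (p := p)
  set B : Set (HilbertCube a) := {x | (∀ n ∈ S, DifferentiableAt ℝ (slice F n x) (x.1 n)) ∧
    ∀ k : ℕ, |∑ n : S, TopologicalSpace.denseSeq (S → ℝ) k n * deriv (slice F n x) (x.1 n)| ≤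
      K * (∑ n, |TopologicalSpace.denseSeq (S → ℝ) k n| ^ (p : ℝ)) ^ (1 / (p : ℝ))} with hBdef
  have hB : MeasurableSet B := by
    have e : B = (⋂ n ∈ S, {x | DifferentiableAt ℝ (slice F n x) (x.1 n)}) ∩ ⋂ k : ℕ,
        {x | |∑ n : S, TopologicalSpace.denseSeq (S → ℝ) k n * deriv (slice F n x) (x.1 n)| ≤
          K * (∑ n, |TopologicalSpace.denseSeq (S → ℝ) k n| ^ (p : ℝ)) ^ (1 / (p : ℝ))} := by
      ext x
      simp [hBdef]
    rw [e]
    refine MeasurableSet.inter (S.measurableSet_biInter fun n _ =>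
      measurableSet_differentiableAt_slice hF.continuous n) (MeasurableSet.iInter fun k =>
        measurableSet_le ?_ measurable_const)
    have hm (n : S) := measurable_deriv_slice hF.continuous n
    fun_prop
  have hae : ∀ᵐ x ∂measure a, x ∈ B := by
    refine ae_of_forall_ae_patch S hB fun x => ?_
    obtain ⟨C, hC⟩ := exists_lipschitzWith_fill S x
    have hR := ae_restrict_of_ae (a := a) S (hF.comp hC).ae_differentiableAt
    filter_upwards [hR, ae_mem_Ioo (a := a)] with y hy hI
    rw [patch_eq_fill]
    have hco : ∀ n : S, (fill S x fun n => y.1 n).1 n = y.1 n := fun n =>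
      fill_apply_of_mem (t := fun n : S => y.1 n) n (Set.Ioo_subset_Icc_self (hI n))
    have hd := hasDerivAt_slice_fill hy
    refine ⟨fun n hn => ?_, fun k => ?_⟩
    · have h := (hd ⟨n, hn⟩).differentiableAt
      rwa [← hco ⟨n, hn⟩] at h
    · refine le_trans (le_of_eq ?_) (abs_fderiv_fill_le hF hy (TopologicalSpace.denseSeq (S → ℝ) k))
      congr 1
      conv_rhs => rw [← LinearMap.sum_single_apply (fun _ : S => ℝ)
        (TopologicalSpace.denseSeq (S → ℝ) k)]
      rw [map_sum]
      refine Finset.sum_congr rfl fun n _ => ?_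
      rw [hco n, (hd n).deriv, ← smul_eq_mul, ← map_smul]
      congr 1
      ext m
      simp [Pi.single_apply]
  filter_upwards [hae] with x hx
  refine ⟨hx.1, fun c => ?_⟩
  have hcl : IsClosed {c : S → ℝ | |∑ n : S, c n * deriv (slice F n x) (x.1 n)| ≤
      K * (∑ n, |c n| ^ (p : ℝ)) ^ (1 / (p : ℝ))} := by
    refine isClosed_le (by fun_prop) (continuous_const.mul ?_)
    refine Continuous.rpow_const (continuous_finsetSum _ fun n _ => ?_) fun _ =>
      Or.inr (by positivity)
    exact Continuous.rpow_const (by fun_prop) fun _ => Or.inr hp0.le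
  exact hcl.closure_subset_iff.2 (Set.range_subset_iff.2 hx.2)
    (TopologicalSpace.denseRange_denseSeq (S → ℝ) c)

/-- Almost everywhere, all partial derivatives of a Lipschitz function exist, and the gradient
belongs to the dual ball of `l^p` of radius the Lipschitz constant. -/
theorem ae_gradient {F : HilbertCube a → ℝ} {K : ℝ≥0} (hF : LipschitzWith K F) :
    ∀ᵐ x ∂measure a, (∀ n, DifferentiableAt ℝ (slice F n x) (x.1 n)) ∧
      ∀ (S : Finset ℕ) (c : ℕ → ℝ), |∑ n ∈ S, c n * partialDeriv F n x| ≤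
        K * (∑ n ∈ S, |c n| ^ (p : ℝ)) ^ (1 / (p : ℝ)) := by
  filter_upwards [ae_all_iff.2 (ae_gradient_finset hF), ae_mem_Ioo (a := a)] with x hx hI
  refine ⟨fun n => (hx {n}).1 n (Finset.mem_singleton_self n), fun S c => ?_⟩
  have h := (hx S).2 fun n => c n
  rw [Finset.sum_coe_sort S fun n => c n * deriv (slice F n x) (x.1 n),
    Finset.sum_coe_sort S fun n => |c n| ^ (p : ℝ)] at h
  simpa only [partialDeriv_eq_deriv F (hI _)] using h

theorem abs_partialDeriv_le {F : HilbertCube a → ℝ} {K : ℝ≥0} (hF : LipschitzWith K F) (n : ℕ) :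
    ∀ᵐ x ∂measure a, |partialDeriv F n x| ≤ K := by
  have hp0 := coe_pos (p := p)
  filter_upwards [ae_gradient hF] with x hx
  simpa using hx.2 {n} fun _ => 1

theorem aestronglyMeasurable_partialDeriv {F : HilbertCube a → ℝ} (hF : Continuous F) (n : ℕ) :
    AEStronglyMeasurable (partialDeriv F n) (measure a) :=
  ⟨_, (measurable_deriv_slice hF n).stronglyMeasurable, by
    filter_upwards [ae_mem_Ioo (a := a)] with x hx using partialDeriv_eq_deriv F (hx n)⟩

theorem memLp_partialDeriv {F : HilbertCube a → ℝ} {K : ℝ≥0} (hF : LipschitzWith K F) (n : ℕ) :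
    MemLp (partialDeriv F n) ∞ (measure a) :=
  memLp_top_of_bound (aestronglyMeasurable_partialDeriv hF.continuous n) K
    (abs_partialDeriv_le hF n)

end HilbertCube

/-! ### Norms in `L^∞` and Lipschitz numbers -/

section General

variable {M : Type*} [MeasurableSpace M] {μ : Measure M}

theorem Linf.norm_le_of_ae {f : Linf μ} {C : ℝ} (hC : 0 ≤ C) (h : ∀ᵐ x ∂μ, |f x| ≤ C) :
    ‖f‖ ≤ C := by
  rw [Lp.norm_def, eLpNorm_exponent_top]
  exact ENNReal.toReal_le_of_le_ofReal hC (eLpNormEssSup_le_of_ae_bound h)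

variable [MetricSpace M]

theorem lipNum_nonneg (f : LipAlg μ) : 0 ≤ lipNum f :=
  Real.sInf_nonneg fun _ ⟨_, k, _, _, e⟩ => e ▸ k.2

theorem lipNorm_nonneg (f : LipAlg μ) : 0 ≤ lipNorm f := (lipNum_nonneg f).trans (le_max_left _ _)

theorem lipNum_le {f : LipAlg μ} {F : M → ℝ} {K : ℝ≥0} (hF : LipschitzWith K F)
    (h : (f : Linf μ) =ᵐ[μ] F) : lipNum f ≤ K :=
  csInf_le ⟨0, fun _ ⟨_, k, _, _, e⟩ => e ▸ k.2⟩ ⟨F, K, hF, h, rfl⟩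

/-- A Lipschitz representative of an element of `Lip(M)`. -/
def rep (f : LipAlg μ) : M → ℝ := f.2.choose

theorem exists_lipschitzWith_rep (f : LipAlg μ) : ∃ K, LipschitzWith K (rep f) :=
  f.2.choose_spec.1

theorem coe_ae_eq_rep (f : LipAlg μ) : (f : Linf μ) =ᵐ[μ] rep f := f.2.choose_spec.2

theorem continuous_rep (f : LipAlg μ) : Continuous (rep f) :=
  (exists_lipschitzWith_rep f).choose_spec.continuous

variable [μ.IsOpenPosMeasure]

/-- The measure charges every nonempty open set, so continuous functions equal almost everywhere are
equal. Thus `rep` involves no real choice and respects the algebra operations. -/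
theorem eq_rep {f : LipAlg μ} {F : M → ℝ} (hF : ∃ K, LipschitzWith K F)
    (h : (f : Linf μ) =ᵐ[μ] F) : F = rep f :=
  (hF.choose_spec.continuous.ae_eq_iff_eq μ (continuous_rep f)).1 (h.symm.trans (coe_ae_eq_rep f))

/-- By uniqueness of the representative, the infimum defining `lipNum` runs over the Lipschitz
constants of a single function and is therefore attained. -/
theorem lipschitzWith_rep (f : LipAlg μ) : LipschitzWith (lipNum f).toNNReal (rep f) := by
  refine LipschitzWith.of_dist_le_mul fun x y => ?_
  rw [Real.coe_toNNReal _ (lipNum_nonneg f)]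
  by_contra! h
  have hd : 0 < dist x y := by
    refine dist_pos.2 fun e => ?_
    simp [e] at h
  obtain ⟨K, hK⟩ := exists_lipschitzWith_rep f
  have h1 : lipNum f < dist (rep f x) (rep f y) / dist x y := by rwa [lt_div_iff₀ hd]
  obtain ⟨_, ⟨F, k, hF, hf, rfl⟩, hk⟩ := exists_lt_of_csInf_lt
    (s := {K : ℝ | ∃ (F : M → ℝ) (k : ℝ≥0), LipschitzWith k F ∧ (f : Linf μ) =ᵐ[μ] F ∧ K = k})
    ⟨(K : ℝ), rep f, K, hK, coe_ae_eq_rep f, rfl⟩ h1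
  rw [lt_div_iff₀ hd] at hk
  rw [eq_rep ⟨k, hF⟩ hf] at hF
  exact absurd (hF.dist_le_mul x y) (not_le.2 hk)

theorem rep_add (f g : LipAlg μ) : rep (f + g) = rep f + rep g := by
  obtain ⟨K, hK⟩ := exists_lipschitzWith_rep f
  obtain ⟨L, hL⟩ := exists_lipschitzWith_rep g
  refine (eq_rep ⟨K + L, hK.add hL⟩ ?_).symm
  filter_upwards [Lp.coeFn_add (f : Linf μ) g, coe_ae_eq_rep f, coe_ae_eq_rep g] with x h1 h2 h3
  change ((f : Linf μ) + (g : Linf μ) : Linf μ) x = _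
  rw [h1, Pi.add_apply, h2, h3]

theorem rep_smul (r : ℝ) (f : LipAlg μ) : rep (r • f) = r • rep f := by
  obtain ⟨K, hK⟩ := exists_lipschitzWith_rep f
  refine (eq_rep ⟨‖r‖₊ * K, (lipschitzWith_smul r).comp hK⟩ ?_).symm
  filter_upwards [Lp.coeFn_smul r (f : Linf μ), coe_ae_eq_rep f] with x h1 h2
  change (r • (f : Linf μ) : Linf μ) x = _
  rw [h1, Pi.smul_apply, h2]
  rfl

theorem rep_mul (f g : LipAlg μ) : rep (f * g) = rep f * rep g := by
  refine (Continuous.ae_eq_iff_eq μ (continuous_rep _)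
    ((continuous_rep f).mul (continuous_rep g))).1 ?_
  filter_upwards [Linf.coeFn_mul (f : Linf μ) g, coe_ae_eq_rep f, coe_ae_eq_rep g,
    coe_ae_eq_rep (f * g)] with x h1 h2 h3 h4
  rw [← h4]
  change ((f : Linf μ) * (g : Linf μ) : Linf μ) x = _
  rw [h1, h2, h3]
  rfl

end General

namespace HilbertCube

variable {p : ℝ≥0} [hp : Fact (1 ≤ p)] {a : lp (fun _ : ℕ => ℝ) p}

variable [ha : Fact (∀ n, 0 < a n)]

/-! ### The measure has full support -/

theorem factor_pos {n : ℕ} {U : Set (Set.Icc (0 : ℝ) (a n))} (hU : IsOpen U) (hne : U.Nonempty) :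
    0 < factor a n U := by
  obtain ⟨V, hV, rfl⟩ := isOpen_induced_iff.1 hU
  obtain ⟨t, ht⟩ := hne
  rw [← Measure.map_apply measurable_subtype_coe hV.measurableSet, map_val_factor,
    Measure.smul_apply, smul_eq_mul, Measure.restrict_apply hV.measurableSet]
  refine ENNReal.mul_pos (ENNReal.inv_ne_zero.2 ENNReal.ofReal_ne_top) (ne_of_gt ?_)
  -- The point `t` may be an endpoint, so it is replaced by a nearby interior point, around which `V
  -- ∩ (0, a n)` is open in `ℝ`.
  have hc : (t : ℝ) ∈ closure (Set.Ioo 0 (a n)) := by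
    rw [closure_Ioo (ha.out n).ne]
    exact t.2
  obtain ⟨s, hs⟩ := mem_closure_iff.1 hc V hV ht
  exact ((hV.inter isOpen_Ioo).measure_pos volume ⟨s, hs⟩).trans_le
    (measure_mono (Set.inter_subset_inter_right _ Set.Ioo_subset_Icc_self))

instance isOpenPosMeasure_measure : (measure a).IsOpenPosMeasure := by
  refine ⟨fun U hU ⟨x, hx⟩ => ne_of_gt ?_⟩
  rw [measure, Measure.map_apply measurable_ofPi hU.measurableSet]
  obtain ⟨I, u, hu, hs⟩ := isOpen_pi_iff.1 (hU.preimage continuous_ofPi) x.coord hx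
  refine lt_of_lt_of_le ?_ (measure_mono hs)
  rw [Measure.infinitePi_pi (factor a) fun i hi => (hu i hi).1.measurableSet]
  exact pos_iff_ne_zero.2 (Finset.prod_ne_zero_iff.2 fun i hi =>
    (factor_pos (hu i hi).1 ⟨_, (hu i hi).2⟩).ne')

/-! ### Lipschitz functions on the cube as elements of `Lip(M)` -/

theorem memLp_of_continuous {F : HilbertCube a → ℝ} (hF : Continuous F) :
    MemLp F ∞ (measure a) := by
  obtain ⟨C, hC⟩ := isCompact_univ.exists_bound_of_continuousOn hF.continuousOn
  exact memLp_top_of_bound hF.aestronglyMeasurable C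
    (Eventually.of_forall fun x => hC x (Set.mem_univ x))

/-- The class of a Lipschitz function. -/
def lipMk (F : HilbertCube a → ℝ) (hF : ∃ K, LipschitzWith K F) : LipAlg (measure a) :=
  ⟨(memLp_of_continuous hF.choose_spec.continuous).toLp F, F, hF, MemLp.coeFn_toLp _⟩

theorem coe_lipMk (F : HilbertCube a → ℝ) (hF : ∃ K, LipschitzWith K F) :
    (lipMk F hF : Linf (measure a)) =ᵐ[measure a] F :=
  MemLp.coeFn_toLp (memLp_of_continuous hF.choose_spec.continuous)

@[simp] theorem rep_lipMk (F : HilbertCube a → ℝ) (hF : ∃ K, LipschitzWith K F) :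
    rep (lipMk F hF) = F := (eq_rep hF (coe_lipMk F hF)).symm

theorem ext_rep {f g : LipAlg (measure a)} (h : rep f = rep g) : f = g := by
  refine Subtype.ext (Lp.ext ?_)
  have := coe_ae_eq_rep g
  rw [← h] at this
  exact (coe_ae_eq_rep f).trans this.symm

theorem lipNorm_lipMk_le {F : HilbertCube a → ℝ} {K : ℝ≥0} (hF : LipschitzWith K F) {C : ℝ}
    (hKC : K ≤ C) (hC : ∀ x, |F x| ≤ C) : lipNorm (lipMk F ⟨K, hF⟩) ≤ C := by
  refine max_le ((lipNum_le hF (coe_lipMk F _)).trans hKC)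
    (Linf.norm_le_of_ae (K.2.trans hKC) ?_)
  filter_upwards [coe_lipMk F ⟨K, hF⟩] with x hx
  rw [hx]
  exact hC x

/-! ### The partial derivatives as derivations -/

theorem slice_add (F G : HilbertCube a → ℝ) (n : ℕ) (x : HilbertCube a) :
    slice (F + G) n x = slice F n x + slice G n x := rfl

theorem slice_smul (r : ℝ) (F : HilbertCube a → ℝ) (n : ℕ) (x : HilbertCube a) :
    slice (r • F) n x = r • slice F n x := rfl

theorem slice_mul (F G : HilbertCube a → ℝ) (n : ℕ) (x : HilbertCube a) :
    slice (F * G) n x = slice F n x * slice G n x := rfl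

theorem memLp_partialDeriv_rep (n : ℕ) (f : LipAlg (measure a)) :
    MemLp (partialDeriv (rep f) n) ∞ (measure a) :=
  memLp_partialDeriv (exists_lipschitzWith_rep f).choose_spec n

/-- The class of the `n`-th partial derivative. -/
def pderivFun (n : ℕ) (f : LipAlg (measure a)) : Linf (measure a) :=
  (memLp_partialDeriv_rep n f).toLp _

theorem coe_pderivFun (n : ℕ) (f : LipAlg (measure a)) :
    pderivFun n f =ᵐ[measure a] partialDeriv (rep f) n :=
  MemLp.coeFn_toLp (memLp_partialDeriv_rep n f)

theorem ae_hasDerivAt_slice (n : ℕ) (f : LipAlg (measure a)) :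
    ∀ᵐ x ∂measure a, HasDerivAt (slice (rep f) n x) (partialDeriv (rep f) n x) (x.1 n) := by
  filter_upwards [ae_gradient (lipschitzWith_rep f), ae_mem_Ioo (a := a)] with x hx hI
  rw [partialDeriv_eq_deriv _ (hI n)]
  exact (hx.1 n).hasDerivAt

/-- The partial derivative `∂/∂x_n` as a derivation `Lip(M) → L^∞(M)`. -/
def pderiv (n : ℕ) : Derivation ℝ (LipAlg (measure a)) (Linf (measure a)) :=
  Derivation.mk' {
    toFun := pderivFun n
    map_add' := fun f g => by
      refine Lp.ext ?_
      filter_upwards [coe_pderivFun n f, coe_pderivFun n g, coe_pderivFun n (f + g),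
        ae_hasDerivAt_slice n f, ae_hasDerivAt_slice n g, ae_mem_Ioo (a := a),
        Lp.coeFn_add (pderivFun n f) (pderivFun n g)] with x h1 h2 h3 h4 h5 h6 h7
      rw [h7, Pi.add_apply, h1, h2, h3, partialDeriv_eq_deriv _ (h6 n), rep_add, slice_add]
      exact (h4.add h5).deriv
    map_smul' := fun r f => by
      refine Lp.ext ?_
      filter_upwards [coe_pderivFun n f, coe_pderivFun n (r • f),
        ae_hasDerivAt_slice n f, ae_mem_Ioo (a := a),
        Lp.coeFn_smul r (pderivFun n f)] with x h1 h3 h4 h6 h7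
      rw [RingHom.id_apply, h7, Pi.smul_apply, h1, h3, partialDeriv_eq_deriv _ (h6 n), rep_smul,
        slice_smul]
      exact (h4.const_smul r).deriv } fun f g => by
      change pderivFun n (f * g) =
        (f : Linf (measure a)) * pderivFun n g + (g : Linf (measure a)) * pderivFun n f
      refine Lp.ext ?_
      filter_upwards [coe_pderivFun n f, coe_pderivFun n g, coe_pderivFun n (f * g),
        ae_hasDerivAt_slice n f, ae_hasDerivAt_slice n g, ae_mem_Ioo (a := a),
        Lp.coeFn_add ((f : Linf (measure a)) * pderivFun n g)
          ((g : Linf (measure a)) * pderivFun n f),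
        Linf.coeFn_mul (f : Linf (measure a)) (pderivFun n g),
        Linf.coeFn_mul (g : Linf (measure a)) (pderivFun n f),
        coe_ae_eq_rep f, coe_ae_eq_rep g] with x h1 h2 h3 h4 h5 h6 h7 h8 h9 h10 h11
      rw [h7, Pi.add_apply, h8, h9, h10, h11, h1, h2, h3, partialDeriv_eq_deriv _ (h6 n), rep_mul,
        slice_mul, (h4.mul h5).deriv, slice_self, slice_self]
      ring

theorem coe_pderiv (n : ℕ) (f : LipAlg (measure a)) :
    pderiv n f =ᵐ[measure a] partialDeriv (rep f) n := coe_pderivFun n f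

theorem ae_abs_sum_pderiv_le (f : LipAlg (measure a)) :
    ∀ᵐ x ∂measure a, ∀ (S : Finset ℕ) (c : ℕ → ℝ), |∑ n ∈ S, c n * pderiv n f x| ≤
      lipNum f * (∑ n ∈ S, |c n| ^ (p : ℝ)) ^ (1 / (p : ℝ)) := by
  filter_upwards [ae_gradient (lipschitzWith_rep f),
    ae_all_iff.2 fun n => coe_pderiv n f] with x hx he
  intro S c
  simp only [he]
  rw [Real.coe_toNNReal _ (lipNum_nonneg f)] at hx
  exact hx.2 S c

theorem ae_sum_abs_pderiv_le (f : LipAlg (measure a)) :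
    ∀ᵐ x ∂measure a, ∀ (S : Finset ℕ) (c : ℕ → ℝ), ∑ n ∈ S, |c n * pderiv n f x| ≤
      lipNum f * (∑ n ∈ S, |c n| ^ (p : ℝ)) ^ (1 / (p : ℝ)) := by
  filter_upwards [ae_abs_sum_pderiv_le f] with x hx
  intro S c
  -- Flipping signs makes every term nonnegative and leaves the right-hand side unchanged; the
  -- resulting absolute bound is what makes convergence unconditional.
  have h := hx S fun n => if 0 ≤ c n * pderiv n f x then c n else -c n
  have h1 : ∀ n, (if 0 ≤ c n * pderiv n f x then c n else -c n) * pderiv n f x =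
      |c n * pderiv n f x| := fun n => by
    split_ifs with h0
    · rw [abs_of_nonneg h0]
    · rw [abs_of_neg (not_le.1 h0), neg_mul]
  have h2 : ∀ n, |if 0 ≤ c n * pderiv n f x then c n else -c n| = |c n| := fun n => by
    split_ifs
    · rfl
    · exact abs_neg _
  simp only [h1, h2] at h
  exact (le_abs_self _).trans h

theorem norm_pderiv_le (n : ℕ) (f : LipAlg (measure a)) : ‖pderiv n f‖ ≤ lipNum f := by
  refine Linf.norm_le_of_ae (lipNum_nonneg f) ?_
  have hp0 := coe_pos (p := p)
  filter_upwards [ae_abs_sum_pderiv_le f] with x hx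
  simpa using hx {n} fun _ => 1

end HilbertCube

/-! ### Weakly `p`-summable sequences -/

section General

variable {M : Type*} [MeasurableSpace M] {μ : Measure M} {p : ℝ≥0} [hp : Fact (1 ≤ p)]

/-- The pointwise `l^p` norm of a sequence of functions. -/
def pnorm (g : lpSeq p μ) (x : M) : ℝ :=
  (∑' n, |(g : ℕ → Linf μ) n x| ^ (p : ℝ)) ^ (1 / (p : ℝ))

theorem pnorm_nonneg (g : lpSeq p μ) (x : M) : 0 ≤ pnorm g x :=
  Real.rpow_nonneg (tsum_nonneg fun _ => Real.rpow_nonneg (abs_nonneg _) _) _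

theorem exists_ae_sum_range_le (g : lpSeq p μ) : ∃ C : ℝ, ∀ᵐ x ∂μ, ∀ N : ℕ,
    ∑ n ∈ Finset.range N, |(g : ℕ → Linf μ) n x| ^ (p : ℝ) ≤ C := by
  obtain ⟨C, hC⟩ := g.2
  exact ⟨C, ae_all_iff.2 hC⟩

theorem ae_summable_rpow (g : lpSeq p μ) :
    ∀ᵐ x ∂μ, Summable fun n => |(g : ℕ → Linf μ) n x| ^ (p : ℝ) := by
  obtain ⟨C, hC⟩ := exists_ae_sum_range_le g
  filter_upwards [hC] with x hx
  exact summable_of_sum_range_le (fun n => Real.rpow_nonneg (abs_nonneg _) _) hx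

theorem ae_sum_rpow_le_pnorm (g : lpSeq p μ) : ∀ᵐ x ∂μ, ∀ S : Finset ℕ,
    (∑ n ∈ S, |(g : ℕ → Linf μ) n x| ^ (p : ℝ)) ^ (1 / (p : ℝ)) ≤ pnorm g x := by
  filter_upwards [ae_summable_rpow g] with x hx
  intro S
  refine Real.rpow_le_rpow (Finset.sum_nonneg fun n _ => by positivity)
    (hx.sum_le_tsum S fun n _ => by positivity) (by positivity)

/-- `seqNorm` is a `toReal`, which would be `0` on an infinite value; the uniform bound on the
partial sums excludes that case. -/
theorem ae_pnorm_le_seqNorm (g : lpSeq p μ) : ∀ᵐ x ∂μ, pnorm g x ≤ seqNorm g := by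
  obtain ⟨C, hC⟩ := exists_ae_sum_range_le g
  have h1 : ∀ᵐ x ∂μ, ‖pnorm g x‖ ≤ C ^ (1 / (p : ℝ)) := by
    filter_upwards [hC] with x hx
    rw [Real.norm_of_nonneg (pnorm_nonneg g x)]
    exact Real.rpow_le_rpow (tsum_nonneg fun _ => by positivity)
      (Real.tsum_le_of_sum_range_le (fun n => by positivity) hx) (by positivity)
  have h2 : eLpNorm (pnorm g) ∞ μ ≠ ∞ := by
    rw [eLpNorm_exponent_top]
    exact (eLpNormEssSup_lt_top_of_ae_bound h1).ne
  have h3 : ∀ᵐ x ∂μ, ‖pnorm g x‖ₑ ≤ eLpNorm (pnorm g) ∞ μ := by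
    rw [eLpNorm_exponent_top]
    exact ae_le_eLpNormEssSup
  filter_upwards [h3] with x hx
  have h4 := ENNReal.toReal_mono h2 hx
  rwa [toReal_enorm, Real.norm_of_nonneg (pnorm_nonneg g x)] at h4

theorem seqNorm_nonneg (g : lpSeq p μ) : 0 ≤ seqNorm g := ENNReal.toReal_nonneg

theorem seqNorm_le {g : lpSeq p μ} {C : ℝ} (hC : 0 ≤ C) (h : ∀ᵐ x ∂μ, pnorm g x ≤ C) :
    seqNorm g ≤ C := by
  change (eLpNorm (pnorm g) ∞ μ).toReal ≤ C
  rw [eLpNorm_exponent_top]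
  refine ENNReal.toReal_le_of_le_ofReal hC (eLpNormEssSup_le_of_ae_bound ?_)
  filter_upwards [h] with x hx
  rwa [Real.norm_of_nonneg (pnorm_nonneg g x)]

theorem coe_add_apply (g g' : lpSeq p μ) : ∀ᵐ x ∂μ, ∀ n,
    ((g + g' : lpSeq p μ) : ℕ → Linf μ) n x =
      (g : ℕ → Linf μ) n x + (g' : ℕ → Linf μ) n x :=
  ae_all_iff.2 fun n => Lp.coeFn_add ((g : ℕ → Linf μ) n) ((g' : ℕ → Linf μ) n)

theorem coe_smul_apply (u : Linf μ) (g : lpSeq p μ) : ∀ᵐ x ∂μ, ∀ n,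
    ((u • g : lpSeq p μ) : ℕ → Linf μ) n x = u x * (g : ℕ → Linf μ) n x :=
  ae_all_iff.2 fun n => Linf.coeFn_mul u ((g : ℕ → Linf μ) n)

end General

namespace HilbertCube

variable {p : ℝ≥0} [hp : Fact (1 ≤ p)] {a : lp (fun _ : ℕ => ℝ) p}

variable [ha : Fact (∀ n, 0 < a n)]

/-! ### The vector field with given coefficients -/

/-- Pointwise duality: `g` lies in `l^p`, and the gradient of `f` lies in the dual ball of radius
`lipNum f`. -/
theorem ae_summable_mul_pderiv (g : lpSeq p (measure a)) (f : LipAlg (measure a)) :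
    ∀ᵐ x ∂measure a, Summable (fun n => g.1 n x * pderiv n f x) ∧
      ∀ S : Finset ℕ, ∑ n ∈ S, |g.1 n x * pderiv n f x| ≤ lipNum f * pnorm g x := by
  filter_upwards [ae_sum_rpow_le_pnorm g, ae_sum_abs_pderiv_le f] with x h1 h2
  have h3 : ∀ S : Finset ℕ, ∑ n ∈ S, |g.1 n x * pderiv n f x| ≤ lipNum f * pnorm g x := fun S =>
    (h2 S fun n => g.1 n x).trans (mul_le_mul_of_nonneg_left (h1 S) (lipNum_nonneg f))
  exact ⟨Summable.of_abs (summable_of_sum_le (fun n => abs_nonneg _) h3), h3⟩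

theorem abs_le_of_hasSum_of_sum_abs_le {u : ℕ → ℝ} {s C : ℝ} (hs : HasSum u s)
    (h : ∀ S : Finset ℕ, ∑ n ∈ S, |u n| ≤ C) : |s| ≤ C :=
  le_of_tendsto ((continuous_abs.tendsto s).comp hs)
    (Eventually.of_forall fun S => (Finset.abs_sum_le_sum_abs _ S).trans (h S))

theorem ae_abs_tsum_le (g : lpSeq p (measure a)) (f : LipAlg (measure a)) :
    ∀ᵐ x ∂measure a, |∑' n, g.1 n x * pderiv n f x| ≤ lipNum f * pnorm g x := by
  filter_upwards [ae_summable_mul_pderiv g f] with x hx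
  refine abs_le_of_hasSum_of_sum_abs_le hx.1.hasSum fun S => hx.2 S

theorem memLp_tsum (g : lpSeq p (measure a)) (f : LipAlg (measure a)) :
    MemLp (fun x => ∑' n, g.1 n x * pderiv n f x) ∞ (measure a) := by
  refine memLp_top_of_bound (aestronglyMeasurable_of_tendsto_ae atTop
    (f := fun N x => ∑ n ∈ Finset.range N, g.1 n x * pderiv n f x) (fun N => ?_) ?_)
    (lipNum f * seqNorm g) ?_
  · refine Finset.aestronglyMeasurable_fun_sum _ fun n _ => ?_
    exact (Lp.aestronglyMeasurable (g.1 n)).mul (Lp.aestronglyMeasurable (pderiv n f))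
  · filter_upwards [ae_summable_mul_pderiv g f] with x hx
    exact hx.1.hasSum.tendsto_sum_nat
  · filter_upwards [ae_abs_tsum_le g f, ae_pnorm_le_seqNorm g] with x h1 h2
    exact h1.trans (mul_le_mul_of_nonneg_left h2 (lipNum_nonneg f))

/-- The class of `∑ g_n ∂f/∂x_n`. -/
def comboFun (g : lpSeq p (measure a)) (f : LipAlg (measure a)) : Linf (measure a) :=
  (memLp_tsum g f).toLp _

theorem ae_hasSum_comboFun (g : lpSeq p (measure a)) (f : LipAlg (measure a)) :
    ∀ᵐ x ∂measure a, HasSum (fun n => g.1 n x * pderiv n f x) (comboFun g f x) := by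
  filter_upwards [ae_summable_mul_pderiv g f, (memLp_tsum g f).coeFn_toLp] with x h1 h2
  rw [comboFun, h2]
  exact h1.1.hasSum

/-- The derivation `f ↦ ∑ g_n ∂f/∂x_n`. -/
def combo (g : lpSeq p (measure a)) : Derivation ℝ (LipAlg (measure a)) (Linf (measure a)) :=
  Derivation.mk' {
    toFun := comboFun g
    map_add' := fun f f' => by
      refine Lp.ext ?_
      filter_upwards [ae_hasSum_comboFun g f, ae_hasSum_comboFun g f',
        ae_hasSum_comboFun g (f + f'), Lp.coeFn_add (comboFun g f) (comboFun g f'),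
        ae_all_iff.2 fun n => Lp.coeFn_add (pderiv n f) (pderiv n f')] with x h1 h2 h3 h4 h5
      rw [h4]
      refine h3.unique ((h1.add h2).congr_fun fun n => ?_)
      rw [map_add, h5 n, Pi.add_apply, mul_add]
    map_smul' := fun r f => by
      refine Lp.ext ?_
      filter_upwards [ae_hasSum_comboFun g f, ae_hasSum_comboFun g (r • f),
        Lp.coeFn_smul r (comboFun g f),
        ae_all_iff.2 fun n => Lp.coeFn_smul r (pderiv n f)] with x h1 h3 h4 h5
      rw [RingHom.id_apply, h4]
      refine h3.unique ((h1.mul_left r).congr_fun fun n => ?_)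
      rw [Derivation.map_smul, h5 n, Pi.smul_apply, smul_eq_mul, mul_left_comm] } fun f f' => by
      change comboFun g (f * f') =
        (f : Linf (measure a)) * comboFun g f' + (f' : Linf (measure a)) * comboFun g f
      refine Lp.ext ?_
      filter_upwards [ae_hasSum_comboFun g f, ae_hasSum_comboFun g f',
        ae_hasSum_comboFun g (f * f'),
        Lp.coeFn_add ((f : Linf (measure a)) * comboFun g f')
          ((f' : Linf (measure a)) * comboFun g f),
        Linf.coeFn_mul (f : Linf (measure a)) (comboFun g f'),
        Linf.coeFn_mul (f' : Linf (measure a)) (comboFun g f),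
        ae_all_iff.2 fun n => Lp.coeFn_add ((f : Linf (measure a)) * pderiv n f')
          ((f' : Linf (measure a)) * pderiv n f),
        ae_all_iff.2 fun n => Linf.coeFn_mul (f : Linf (measure a)) (pderiv n f'),
        ae_all_iff.2 fun n => Linf.coeFn_mul (f' : Linf (measure a)) (pderiv n f)]
        with x h1 h2 h3 h4 h5 h6 h7 h8 h9
      rw [h4, Pi.add_apply, h5, h6]
      refine h3.unique (((h2.mul_left _).add (h1.mul_left _)).congr_fun fun n => ?_)
      have e : pderiv n (f * f') = (f : Linf (measure a)) * pderiv n f' +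
        (f' : Linf (measure a)) * pderiv n f := (pderiv n).leibniz f f'
      rw [e, h7 n, Pi.add_apply, h8 n, h9 n]
      ring

theorem ae_hasSum_combo (g : lpSeq p (measure a)) (f : LipAlg (measure a)) :
    ∀ᵐ x ∂measure a, HasSum (fun n => g.1 n x * pderiv n f x) (combo g f x) :=
  ae_hasSum_comboFun g f

theorem combo_add (g g' : lpSeq p (measure a)) : combo (g + g') = combo g + combo g' := by
  refine Derivation.ext fun f => Lp.ext ?_
  filter_upwards [ae_hasSum_combo g f, ae_hasSum_combo g' f, ae_hasSum_combo (g + g') f,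
    coe_add_apply g g', Lp.coeFn_add (combo g f) (combo g' f)] with x h1 h2 h3 h4 h5
  rw [Derivation.add_apply, h5]
  refine h3.unique ((h1.add h2).congr_fun fun n => ?_)
  rw [h4 n, add_mul]

theorem combo_smul (u : Linf (measure a)) (g : lpSeq p (measure a)) :
    combo (u • g) = u • combo g := by
  refine Derivation.ext fun f => Lp.ext ?_
  filter_upwards [ae_hasSum_combo g f, ae_hasSum_combo (u • g) f,
    coe_smul_apply u g, Linf.coeFn_mul u (combo g f)] with x h1 h3 h4 h5
  rw [Derivation.smul_apply, smul_eq_mul, h5]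
  refine h3.unique ((h1.mul_left (u x)).congr_fun fun n => ?_)
  rw [h4 n, mul_assoc]

theorem ae_abs_combo_le (g : lpSeq p (measure a)) (f : LipAlg (measure a)) :
    ∀ᵐ x ∂measure a, |combo g f x| ≤ lipNum f * pnorm g x := by
  filter_upwards [ae_abs_tsum_le g f, ae_hasSum_combo g f] with x h1 h2
  rwa [← h2.tsum_eq]

theorem norm_combo_le (g : lpSeq p (measure a)) (f : LipAlg (measure a)) :
    ‖combo g f‖ ≤ seqNorm g * lipNum f := by
  refine Linf.norm_le_of_ae (mul_nonneg (seqNorm_nonneg g) (lipNum_nonneg f)) ?_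
  filter_upwards [ae_abs_combo_le g f, ae_pnorm_le_seqNorm g] with x h1 h2
  rw [mul_comm]
  exact h1.trans (mul_le_mul_of_nonneg_left h2 (lipNum_nonneg f))

/-- The integrals of the absolute values sum to at most `lipNum f * seqNorm g * ∫ |h|`, so sum and
integral may be interchanged. This is the weak* convergence of the series. -/
theorem hasSum_integral_combo (g : lpSeq p (measure a)) (f : LipAlg (measure a))
    (h : Lp ℝ 1 (measure a)) :
    HasSum (fun n => ∫ x, g.1 n x * pderiv n f x * h x ∂measure a)
      (∫ x, combo g f x * h x ∂measure a) := by
  have hi (n : ℕ) : Integrable (fun x => g.1 n x * pderiv n f x * h x) (measure a) := by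
    refine (integrable_mul (g.1 n * pderiv n f) h).congr ?_
    filter_upwards [Linf.coeFn_mul (g.1 n) (pderiv n f)] with x hx
    rw [hx]
  have hs : Summable fun n => ∫ x, ‖g.1 n x * pderiv n f x * h x‖ ∂measure a := by
    refine summable_of_sum_le (c := ∫ x, lipNum f * seqNorm g * ‖h x‖ ∂measure a)
      (fun n => integral_nonneg fun x => norm_nonneg _) fun S => ?_
    rw [← integral_finsetSum _ fun n _ => (hi n).norm]
    refine integral_mono_ae (integrable_finsetSum _ fun n _ => (hi n).norm)
      ((L1.integrable_coeFn h).norm.const_mul _) ?_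
    filter_upwards [ae_summable_mul_pderiv g f, ae_pnorm_le_seqNorm g] with x h1 h2
    simp only [norm_mul _ (h x)]
    rw [← Finset.sum_mul]
    exact mul_le_mul_of_nonneg_right ((h1.2 S).trans
      (mul_le_mul_of_nonneg_left h2 (lipNum_nonneg f))) (norm_nonneg _)
  have hsum := hasSum_integral_of_summable_integral_norm hi hs
  have e : ∫ x, ∑' n, g.1 n x * pderiv n f x * h x ∂measure a =
      ∫ x, combo g f x * h x ∂measure a := by
    refine integral_congr_ae ?_
    filter_upwards [ae_hasSum_combo g f] with x hx
    exact (hx.mul_right (h x)).tsum_eq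
  rwa [e] at hsum

/-! ### Integration by parts -/

theorem slice_patch (F : HilbertCube a → ℝ) (n : ℕ) (x y : HilbertCube a) :
    slice F n (patch {n} x y) = slice F n x := by
  funext s
  rw [slice_apply, slice_apply]
  refine congrArg F (congrArg ofPi ?_)
  simp [patch, Finset.piecewise_singleton]

theorem patch_apply_self (n : ℕ) (x y : HilbertCube a) : (patch {n} x y).1 n = y.1 n := by
  change ((patch {n} x y).coord n : ℝ) = y.coord n
  simp [patch]

theorem lipschitzWith_slice {F : HilbertCube a → ℝ} {K : ℝ≥0} (hF : LipschitzWith K F)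
    (n : ℕ) (x : HilbertCube a) : LipschitzWith K (slice F n x) := by
  have hp0 := coe_pos (p := p)
  refine LipschitzWith.of_dist_le_mul fun s t => ?_
  rw [slice_apply, slice_apply]
  refine (hF.dist_le_mul _ _).trans (mul_le_mul_of_nonneg_left ?_ K.2)
  rw [dist_eq_sum (S := {n}) fun m hm => ?_]
  · rw [Finset.sum_singleton, ← Real.rpow_mul (abs_nonneg _), mul_one_div_cancel hp0.ne',
      Real.rpow_one]
    change |((ofPi (Function.update x.coord n _)).coord n : ℝ) -
      (ofPi (Function.update x.coord n _)).coord n| ≤ _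
    rw [coord_ofPi, coord_ofPi, Function.update_self, Function.update_self]
    exact Set.abs_projIcc_sub_projIcc _
  · change ((ofPi (Function.update x.coord n _)).coord m : ℝ) =
      (ofPi (Function.update x.coord n _)).coord m
    rw [Finset.mem_singleton] at hm
    simp [hm]

theorem integral_patch {φ : HilbertCube a → ℝ} (hφ : Measurable φ) {C : ℝ}
    (hC : ∀ x, |φ x| ≤ C) (S : Finset ℕ) :
    ∫ x, φ x ∂measure a = ∫ x, ∫ y, φ (patch S x y) ∂measure a ∂measure a := by
  have hm := (measurePreserving_patch (a := a) S).measurable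
  conv_lhs => rw [← (measurePreserving_patch (a := a) S).map_eq]
  rw [integral_map hm.aemeasurable hφ.aestronglyMeasurable, integral_prod]
  exact Integrable.of_bound (hφ.comp hm).aestronglyMeasurable C (Eventually.of_forall fun _ => hC _)

theorem integral_comp_apply {ψ : ℝ → ℝ} (hψ : Measurable ψ) (n : ℕ) :
    ∫ y, ψ (y.1 n) ∂measure a = (a n)⁻¹ * ∫ t in (0 : ℝ)..a n, ψ t := by
  rw [← integral_map (φ := fun y : HilbertCube a => y.1 n) (continuous_apply n).aemeasurable
    hψ.aestronglyMeasurable, map_apply_measure, integral_smul_measure,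
    intervalIntegral.integral_of_le (ha.out n).le, integral_Icc_eq_integral_Ioc,
    ENNReal.toReal_inv, ENNReal.toReal_ofReal (ha.out n).le, smul_eq_mul]

/-- A function vanishing on the two faces orthogonal to the `n`-th direction. -/
def VanishOnFaces (n : ℕ) (F : HilbertCube a → ℝ) : Prop :=
  ∀ x, x.1 n = 0 ∨ x.1 n = a n → F x = 0

theorem slice_eq_zero {n : ℕ} {F : HilbertCube a → ℝ} (h : VanishOnFaces n F)
    (x : HilbertCube a) {s : ℝ} (hs : s = 0 ∨ s = a n) : slice F n x s = 0 := by
  have hI : s ∈ Set.Icc 0 (a n) := by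
    rcases hs with rfl | rfl
    exacts [Set.left_mem_Icc.2 (ha.out n).le, Set.right_mem_Icc.2 (ha.out n).le]
  rw [slice_apply, Set.projIcc_of_mem _ hI]
  refine h _ ?_
  have e : (ofPi (Function.update x.coord n ⟨s, hI⟩)).1 n = s := by
    change ((ofPi (Function.update x.coord n ⟨s, hI⟩)).coord n : ℝ) = s
    simp
  rwa [e]

/-- Integrate first in the `n`-th direction. A slice is Lipschitz, hence absolutely continuous, so
the fundamental theorem of calculus leaves only its values on the two faces. -/
theorem integral_pderiv_eq_zero {n : ℕ} {u : LipAlg (measure a)}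
    (hu : VanishOnFaces n (rep u)) : ∫ x, pderiv n u x ∂measure a = 0 := by
  obtain ⟨K, hK⟩ := exists_lipschitzWith_rep u
  have e : ∫ x, pderiv n u x ∂measure a =
      ∫ x, deriv (slice (rep u) n x) (x.1 n) ∂measure a := by
    refine integral_congr_ae ?_
    filter_upwards [coe_pderiv n u, ae_mem_Ioo (a := a)] with x h1 h2
    rw [h1, partialDeriv_eq_deriv _ (h2 n)]
  rw [e, integral_patch (C := K) (measurable_deriv_slice hK.continuous n)
    (fun x => norm_deriv_le_of_lipschitz (lipschitzWith_slice hK n x)) {n}]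
  refine integral_eq_zero_of_ae (Eventually.of_forall fun x => ?_)
  simp only [slice_patch, patch_apply_self]
  rw [integral_comp_apply (measurable_deriv _),
    (lipschitzWith_slice hK n x).lipschitzOnWith.absolutelyContinuousOnInterval.integral_deriv_eq_sub,
    slice_eq_zero hu x (Or.inl rfl), slice_eq_zero hu x (Or.inr rfl)]
  simp

/-- The product `f * w` vanishes on the faces along with `w`, so the Leibniz rule integrates to
zero. The derivative moves to `w`, leaving an expression that is weak* continuous in `f`. -/
theorem integral_pderiv_mul {n : ℕ} {w : LipAlg (measure a)} (hw : VanishOnFaces n (rep w))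
    (f : LipAlg (measure a)) : ∫ x, pderiv n f x * (w : Linf (measure a)) x ∂measure a =
      -∫ x, (f : Linf (measure a)) x * pderiv n w x ∂measure a := by
  have hi (u v : Linf (measure a)) : Integrable (fun x => u x * v x) (measure a) :=
    (Lp.memLp v).integrable le_top |>.bdd_mul (Lp.aestronglyMeasurable u) (Linf.ae_le_norm u)
  have h0 : ∫ x, pderiv n (f * w) x ∂measure a = 0 := by
    refine integral_pderiv_eq_zero fun x hx => ?_
    rw [rep_mul, Pi.mul_apply, hw x hx, mul_zero]
  have e : pderiv n (f * w) = (f : Linf (measure a)) * pderiv n w +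
    (w : Linf (measure a)) * pderiv n f := (pderiv n).leibniz f w
  have h1 : ∫ x, pderiv n (f * w) x ∂measure a =
      ∫ x, (pderiv n f x * (w : Linf (measure a)) x +
        (f : Linf (measure a)) x * pderiv n w x) ∂measure a := by
    refine integral_congr_ae ?_
    rw [e]
    filter_upwards [Lp.coeFn_add ((f : Linf (measure a)) * pderiv n w)
        ((w : Linf (measure a)) * pderiv n f), Linf.coeFn_mul (f : Linf (measure a)) (pderiv n w),
      Linf.coeFn_mul (w : Linf (measure a)) (pderiv n f)] with x h1 h2 h3
    rw [h1, Pi.add_apply, h2, h3]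
    ring
  rw [integral_add (hi _ _) (hi _ _), h0] at h1
  linarith

/-! ### Density of Lipschitz functions vanishing on faces -/

theorem exists_lipschitzWith_mul {F G : HilbertCube a → ℝ} (hF : ∃ K, LipschitzWith K F)
    (hG : ∃ K, LipschitzWith K G) : ∃ K, LipschitzWith K (F * G) := by
  have h := exists_lipschitzWith_rep (lipMk F hF * lipMk G hG)
  rwa [rep_mul, rep_lipMk, rep_lipMk] at h

/-- The Lipschitz functions as a subalgebra of the continuous functions. -/
def lipSubalgebra (a : lp (fun _ : ℕ => ℝ) p) [Fact (∀ n, 0 < a n)] :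
    Subalgebra ℝ C(HilbertCube a, ℝ) where
  carrier := {F | ∃ K, LipschitzWith K F}
  mul_mem' hF hG := exists_lipschitzWith_mul hF hG
  add_mem' := fun ⟨K, hF⟩ ⟨L, hG⟩ => ⟨K + L, hF.add hG⟩
  algebraMap_mem' r := ⟨0, LipschitzWith.const r⟩

theorem lipSubalgebra_separatesPoints : (lipSubalgebra a).SeparatesPoints := by
  intro x y hxy
  let F : C(HilbertCube a, ℝ) := ⟨fun z => dist z y, by fun_prop⟩
  refine ⟨F, ⟨F, ⟨1, LipschitzWith.dist_left y⟩, rfl⟩, ?_⟩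
  change dist x y ≠ dist y y
  rw [dist_self]
  exact dist_ne_zero.2 hxy

/-- Bounded continuous functions are dense in `L^1`, and the Stone–Weierstrass theorem on the
compact cube approximates them uniformly by Lipschitz functions. -/
theorem exists_lipschitz_integral_sub_le {k : HilbertCube a → ℝ} (hk : Integrable k (measure a))
    {ε : ℝ} (hε : 0 < ε) : ∃ F : HilbertCube a → ℝ, (∃ K, LipschitzWith K F) ∧
      ∫ x, |k x - F x| ∂measure a ≤ ε := by
  obtain ⟨g, hg, hgi⟩ := hk.exists_boundedContinuous_integral_sub_le (half_pos hε)
  obtain ⟨⟨F, hF⟩, hFg⟩ :=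
    ContinuousMap.exists_mem_subalgebra_near_continuous_of_separatesPoints (lipSubalgebra a)
      lipSubalgebra_separatesPoints g g.continuous (ε / 2) (half_pos hε)
  refine ⟨F, hF, ?_⟩
  have hFi : Integrable F (measure a) :=
    (memLp_of_continuous F.continuous).integrable le_top
  calc ∫ x, |k x - F x| ∂measure a
      ≤ ∫ x, (‖k x - g x‖ + ε / 2) ∂measure a := by
        refine integral_mono (hk.sub hFi).abs ((hk.sub hgi).norm.add (integrable_const _))
          fun x => ?_
        have h1 := (hFg x).le
        rw [norm_sub_rev] at h1
        exact (norm_sub_le_norm_sub_add_norm_sub (k x) (g x) (F x)).trans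
          (by simpa using h1)
    _ = ∫ x, ‖k x - g x‖ ∂measure a + ε / 2 := by
        have hkg : Integrable (fun x => ‖k x - g x‖) (measure a) := (hk.sub hgi).norm
        rw [integral_add hkg (integrable_const _)]
        simp
    _ ≤ ε := by linarith

/-- A cutoff function that vanishes on the faces orthogonal to the `n`-th direction. -/
def cutoff (n j : ℕ) (x : HilbertCube a) : ℝ := min 1 (j * min (x.1 n) (a n - x.1 n))

theorem exists_lipschitzWith_apply (n : ℕ) : ∃ K, LipschitzWith K fun x : HilbertCube a => x.1 n :=
  ⟨1, LipschitzWith.of_dist_le_mul fun x y => by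
    simpa [Real.dist_eq] using abs_sub_le_dist x y n⟩

theorem exists_lipschitzWith_cutoff (n j : ℕ) :
    ∃ K, LipschitzWith K (cutoff (a := a) n j) := by
  obtain ⟨K, hK⟩ := exists_lipschitzWith_apply (a := a) n
  have h2 := (lipschitzWith_smul (j : ℝ)).comp
    (hK.min ((LipschitzWith.const (a n)).sub hK))
  exact ⟨_, h2.const_min 1⟩

theorem cutoff_nonneg (n j : ℕ) (x : HilbertCube a) : 0 ≤ cutoff n j x :=
  le_min zero_le_one (mul_nonneg j.cast_nonneg (le_min (x.2 n).1 (sub_nonneg.2 (x.2 n).2)))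

theorem cutoff_le_one (n j : ℕ) (x : HilbertCube a) : cutoff n j x ≤ 1 := min_le_left _ _

theorem vanishOnFaces_cutoff (n j : ℕ) : VanishOnFaces n (cutoff (a := a) n j) := by
  rintro x (h | h) <;> simp [cutoff, h, (ha.out n).le]

theorem tendsto_cutoff (n : ℕ) : ∀ᵐ x ∂measure a,
    Tendsto (fun j => cutoff n j x) atTop (𝓝 1) := by
  filter_upwards [ae_mem_Ioo (a := a)] with x hx
  have hm : 0 < min (x.1 n) (a n - x.1 n) := lt_min (hx n).1 (sub_pos.2 (hx n).2)
  refine tendsto_const_nhds.congr' ?_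
  filter_upwards [eventually_ge_atTop ⌈1 / min (x.1 n) (a n - x.1 n)⌉₊] with j hj
  rw [cutoff, min_eq_left]
  rw [← div_le_iff₀ hm]
  exact Nat.ceil_le.1 hj

/-- A Lipschitz approximation of `k` is multiplied by cutoffs that tend to `1` off the faces;
dominated convergence makes the loss small. -/
theorem exists_vanishOnFaces_integral_sub_le (n : ℕ) {k : HilbertCube a → ℝ}
    (hk : Integrable k (measure a)) {ε : ℝ} (hε : 0 < ε) :
    ∃ w : LipAlg (measure a), VanishOnFaces n (rep w) ∧
      ∫ x, |k x - (w : Linf (measure a)) x| ∂measure a < ε := by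
  obtain ⟨F, hF, hkF⟩ := exists_lipschitz_integral_sub_le hk (half_pos hε)
  have hFc : Continuous F := hF.choose_spec.continuous
  have hFi : Integrable F (measure a) := (memLp_of_continuous hFc).integrable le_top
  have hcc (j : ℕ) : Continuous (cutoff (a := a) n j) :=
    (exists_lipschitzWith_cutoff n j).choose_spec.continuous
  have ht : Tendsto (fun j => ∫ x, |k x - F x * cutoff n j x| ∂measure a) atTop
      (𝓝 (∫ x, |k x - F x| ∂measure a)) := by
    refine tendsto_integral_of_dominated_convergence (fun x => |k x| + |F x|) (fun j => ?_)
      (hk.abs.add hFi.abs) (fun j => Eventually.of_forall fun x => ?_) ?_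
    · exact (hk.aestronglyMeasurable.sub (hFc.mul (hcc j)).aestronglyMeasurable).norm
    · rw [Real.norm_eq_abs, abs_abs]
      refine (abs_sub _ _).trans (add_le_add_right ?_ _)
      rw [abs_mul, abs_of_nonneg (cutoff_nonneg n j x)]
      exact mul_le_of_le_one_right (abs_nonneg _) (cutoff_le_one n j x)
    · filter_upwards [tendsto_cutoff (a := a) n] with x hx
      simpa using ((hx.const_mul (F x)).const_sub (k x)).abs
  obtain ⟨j, hj⟩ := (ht.eventually_lt_const (lt_of_le_of_lt hkF (half_lt_self hε))).exists
  have hL := exists_lipschitzWith_mul hF (exists_lipschitzWith_cutoff n j)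
  refine ⟨lipMk _ hL, fun x hx => ?_, ?_⟩
  · rw [rep_lipMk, Pi.mul_apply, vanishOnFaces_cutoff n j x hx, mul_zero]
  · refine lt_of_eq_of_lt (integral_congr_ae ?_) hj
    filter_upwards [coe_lipMk _ hL] with x hx
    rw [hx]
    rfl

end HilbertCube

/-- The weak* topology of `L^∞(M)` restricted to `Lip(M)`. -/
@[reducible] def weakStarLip {M : Type*} [MeasurableSpace M] [MetricSpace M] (μ : Measure M) :
    TopologicalSpace (LipAlg μ) :=
  TopologicalSpace.induced (fun f : LipAlg μ => (f : Linf μ)) (weakStar μ)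

theorem continuous_integral_mul {M : Type*} [MeasurableSpace M] [MetricSpace M] {μ : Measure M}
    {k : M → ℝ} (hk : Integrable k μ) :
    @Continuous (LipAlg μ) ℝ (weakStarLip μ) _ fun f => ∫ x, (f : Linf μ) x * k x ∂μ := by
  let _ : TopologicalSpace (Linf μ) := weakStar μ
  let _ : TopologicalSpace (LipAlg μ) := weakStarLip μ
  have h1 : Continuous fun (f : Linf μ) (h : Lp ℝ 1 μ) => ∫ x, f x * h x ∂μ :=
    continuous_induced_dom
  have h2 : Continuous fun f : LipAlg μ => (f : Linf μ) := continuous_induced_dom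
  have h3 := ((continuous_apply (hk.toL1 k)).comp h1).comp h2
  refine h3.congr fun f => integral_congr_ae ?_
  filter_upwards [hk.coeFn_toL1] with x hx
  rw [hx]

namespace HilbertCube

variable {p : ℝ≥0} [hp : Fact (1 ≤ p)] {a : lp (fun _ : ℕ => ℝ) p}

variable [ha : Fact (∀ n, 0 < a n)]

/-! ### Weak* continuity -/

theorem integrable_linf (f : Linf (measure a)) : Integrable f (measure a) :=
  (Lp.memLp f).integrable le_top

theorem integrable_linf_mul (f : Linf (measure a)) {k : HilbertCube a → ℝ}
    (hk : Integrable k (measure a)) : Integrable (fun x => f x * k x) (measure a) :=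
  hk.bdd_mul (Lp.aestronglyMeasurable f) (Linf.ae_le_norm f)

/-- For `w` vanishing on the faces, integration by parts gives continuity. On the unit ball
`|∂f/∂x_n| ≤ 1`, so replacing `k` by `w` costs at most their `L^1` distance, uniformly in `f`. -/
theorem continuousOn_integral_pderiv (n : ℕ) {k : HilbertCube a → ℝ}
    (hk : Integrable k (measure a)) :
    @ContinuousOn (LipAlg (measure a)) ℝ (weakStarLip (measure a)) _
      (fun f => ∫ x, pderiv n f x * k x ∂measure a) {f | lipNorm f ≤ 1} := by
  let _ : TopologicalSpace (LipAlg (measure a)) := weakStarLip (measure a)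
  refine continuousOn_of_uniform_approx_of_continuousOn fun u hu => ?_
  obtain ⟨ε, hε, hu⟩ := Metric.mem_uniformity_dist.1 hu
  obtain ⟨w, hw, hkw⟩ := exists_vanishOnFaces_integral_sub_le n hk hε
  have hwi := integrable_linf (w : Linf (measure a))
  refine ⟨fun f => ∫ x, pderiv n f x * (w : Linf (measure a)) x ∂measure a, ?_, fun f hf => hu ?_⟩
  · simp only [integral_pderiv_mul hw]
    exact (continuous_integral_mul (integrable_linf (pderiv n w))).neg.continuousOn
  · rw [Real.dist_eq, ← integral_sub (integrable_linf_mul _ hk) (integrable_linf_mul _ hwi)]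
    refine lt_of_le_of_lt ((abs_integral_le_integral_abs).trans (integral_mono_ae
      ((integrable_linf_mul _ hk).sub (integrable_linf_mul _ hwi)).abs (hk.sub hwi).abs ?_)) hkw
    filter_upwards [Linf.ae_le_norm (pderiv n f)] with x hx
    have h1 : |pderiv n f x| ≤ 1 :=
      hx.trans ((norm_pderiv_le n f).trans ((le_max_left _ _).trans hf))
    simp only [Pi.sub_apply]
    rw [← mul_sub, abs_mul]
    exact mul_le_of_le_one_left (abs_nonneg _) h1

/-- The pointwise `l^p` norm of the tail of a sequence of functions. -/
def tailNorm (g : lpSeq p (measure a)) (N : ℕ) (x : HilbertCube a) : ℝ :=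
  (∑' n, |g.1 (n + N) x| ^ (p : ℝ)) ^ (1 / (p : ℝ))

theorem ae_abs_combo_sub_sum_le (g : lpSeq p (measure a)) (f : LipAlg (measure a)) :
    ∀ᵐ x ∂measure a, ∀ N, |combo g f x - ∑ n ∈ Finset.range N, g.1 n x * pderiv n f x| ≤
      lipNum f * tailNorm g N x := by
  filter_upwards [ae_hasSum_combo g f, ae_sum_abs_pderiv_le f, ae_summable_rpow g] with x h1 h2 h3
  intro N
  refine abs_le_of_hasSum_of_sum_abs_le ((hasSum_nat_add_iff' N).2 h1) fun S => ?_
  -- The gradient bound on the index set shifted by `N` sees only the coefficients of the tail.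
  have h4 := h2 (S.map (addRightEmbedding N)) fun n => g.1 n x
  simp only [Finset.sum_map, addRightEmbedding_apply] at h4
  refine h4.trans (mul_le_mul_of_nonneg_left (Real.rpow_le_rpow
    (Finset.sum_nonneg fun n _ => by positivity) ?_ (by positivity)) (lipNum_nonneg f))
  exact ((summable_nat_add_iff N).2 h3).sum_le_tsum S fun n _ => by positivity

theorem tendsto_integral_tailNorm (g : lpSeq p (measure a)) {h : HilbertCube a → ℝ}
    (hh : Integrable h (measure a)) :
    Tendsto (fun N => ∫ x, tailNorm g N x * |h x| ∂measure a) atTop (𝓝 0) ∧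
      ∀ N, Integrable (fun x => tailNorm g N x * |h x|) (measure a) := by
  have hp0 := coe_pos (p := p)
  have hm (N : ℕ) : AEStronglyMeasurable (tailNorm g N) (measure a) := by
    refine (AEMeasurable.pow_const (aestronglyMeasurable_of_tendsto_ae atTop
      (f := fun K x => ∑ n ∈ Finset.range K, |g.1 (n + N) x| ^ (p : ℝ)) (fun K => ?_)
      ?_).aemeasurable _).aestronglyMeasurable
    · exact Finset.aestronglyMeasurable_fun_sum _ fun n _ =>
        ((Lp.aestronglyMeasurable (g.1 (n + N))).aemeasurable.abs.pow_const
          (p : ℝ)).aestronglyMeasurable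
    · filter_upwards [ae_summable_rpow g] with x hx
      exact ((summable_nat_add_iff N).2 hx).hasSum.tendsto_sum_nat
  have hb (N : ℕ) : ∀ᵐ x ∂measure a, ‖tailNorm g N x‖ ≤ seqNorm g := by
    filter_upwards [ae_pnorm_le_seqNorm g, ae_summable_rpow g] with x h1 h2
    have h0 : 0 ≤ ∑' n, |g.1 (n + N) x| ^ (p : ℝ) := tsum_nonneg fun n => by positivity
    rw [tailNorm, Real.norm_of_nonneg (by positivity)]
    refine le_trans (Real.rpow_le_rpow h0 ?_ (by positivity)) h1
    rw [← h2.sum_add_tsum_nat_add N]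
    exact le_add_of_nonneg_left (Finset.sum_nonneg fun n _ => by positivity)
  have hi (N : ℕ) : Integrable (fun x => tailNorm g N x * |h x|) (measure a) :=
    hh.abs.bdd_mul (hm N) (hb N)
  refine ⟨?_, hi⟩
  have h0 : (0 : ℝ) = ∫ _, (0 : ℝ) ∂measure a := by simp
  rw [h0]
  refine tendsto_integral_of_dominated_convergence (fun x => seqNorm g * |h x|)
    (fun N => (hi N).aestronglyMeasurable) (hh.abs.const_mul _) (fun N => ?_) ?_
  · filter_upwards [hb N] with x hx
    rw [norm_mul, Real.norm_eq_abs |h x|, abs_abs]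
    exact mul_le_mul_of_nonneg_right hx (abs_nonneg _)
  · refine Eventually.of_forall fun x => ?_
    -- No summability is needed at `x`: if the series diverges, all its tails have the default sum
    -- `0`.
    have h1 := (tendsto_sum_nat_add fun n => |g.1 n x| ^ (p : ℝ)).rpow_const
      (p := 1 / (p : ℝ)) (Or.inr (by positivity))
    rw [Real.zero_rpow (by positivity)] at h1
    have h2 := h1.mul_const |h x|
    rwa [zero_mul] at h2

/-- Finite partial sums are weak* continuous on the unit ball, and there the remainder tested
against `h` is at most `∫ tailNorm g N * |h|`, independently of `f`. -/
theorem weakStarContinuous_combo (g : lpSeq p (measure a)) : WeakStarContinuous (combo g) := by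
  refine (weakStarContinuous_iff _).2 fun h => ?_
  let _ : TopologicalSpace (LipAlg (measure a)) := weakStarLip (measure a)
  have hh : Integrable h (measure a) := L1.integrable_coeFn h
  refine continuousOn_of_uniform_approx_of_continuousOn fun u hu => ?_
  obtain ⟨ε, hε, hu⟩ := Metric.mem_uniformity_dist.1 hu
  obtain ⟨ht, hi⟩ := tendsto_integral_tailNorm g hh
  obtain ⟨N, hN⟩ := (ht.eventually_lt_const hε).exists
  have hgi (n : ℕ) : Integrable (fun x => g.1 n x * h x) (measure a) := integrable_linf_mul _ hh
  refine ⟨fun f => ∑ n ∈ Finset.range N, ∫ x, pderiv n f x * (g.1 n x * h x) ∂measure a,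
    continuousOn_finsetSum _ fun n _ => continuousOn_integral_pderiv n (hgi n),
    fun f hf => hu ?_⟩
  have hs : Integrable (fun x => ∑ n ∈ Finset.range N, pderiv n f x * (g.1 n x * h x))
    (measure a) := integrable_finsetSum _ fun n _ => integrable_linf_mul _ (hgi n)
  have hc : Integrable (fun x => combo g f x * h x) (measure a) := integrable_linf_mul _ hh
  have es := integral_finsetSum (Finset.range N) fun n _ =>
    integrable_linf_mul (pderiv n f) (hgi n)
  beta_reduce
  rw [Real.dist_eq, ← es, ← integral_sub hc hs]
  refine lt_of_le_of_lt ((abs_integral_le_integral_abs).trans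
    (integral_mono_ae (hc.sub hs).abs (hi N) ?_)) hN
  filter_upwards [ae_abs_combo_sub_sum_le g f] with x hx
  have e : combo g f x * h x - ∑ n ∈ Finset.range N, pderiv n f x * (g.1 n x * h x) =
      (combo g f x - ∑ n ∈ Finset.range N, g.1 n x * pderiv n f x) * h x := by
    rw [sub_mul, Finset.sum_mul]
    congr 1
    exact Finset.sum_congr rfl fun n _ => by ring
  rw [e, abs_mul]
  refine mul_le_mul_of_nonneg_right ((hx N).trans ?_) (abs_nonneg _)
  exact mul_le_of_le_one_left (Real.rpow_nonneg (tsum_nonneg fun n => by positivity) _)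
    ((le_max_left _ _).trans hf)

/-- The vector field `∑ g_n ∂/∂x_n`. -/
def comboField (g : lpSeq p (measure a)) : VectorField (measure a) :=
  ⟨combo g, ⟨seqNorm g, fun f => (norm_combo_le g f).trans
    (mul_le_mul_of_nonneg_left (le_max_left _ _) (seqNorm_nonneg g))⟩, weakStarContinuous_combo g⟩

end HilbertCube

section General

variable {M : Type*} [MeasurableSpace M] [MetricSpace M] {μ : Measure M} [μ.IsOpenPosMeasure]

/-! ### Derivations of `Lip(M)` -/

theorem rep_algebraMap (r : ℝ) : rep (algebraMap ℝ (LipAlg μ) r) = fun _ => r :=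
  (eq_rep ⟨0, LipschitzWith.const r⟩ (Linf.coeFn_algebraMap r)).symm

theorem rep_sum {ι : Type*} (S : Finset ι) (f : ι → LipAlg μ) :
    rep (∑ i ∈ S, f i) = ∑ i ∈ S, rep (f i) := by
  classical
  induction S using Finset.induction_on with
  | empty =>
    have h := rep_smul (0 : ℝ) (0 : LipAlg μ)
    rwa [zero_smul, zero_smul] at h
  | insert i S hi ih => rw [Finset.sum_insert hi, Finset.sum_insert hi, rep_add, ih]

theorem ae_leibniz (δ : Derivation ℝ (LipAlg μ) (Linf μ)) (f g : LipAlg μ) :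
    ∀ᵐ x ∂μ, δ (f * g) x = rep f x * δ g x + rep g x * δ f x := by
  have e : δ (f * g) = (f : Linf μ) * δ g + (g : Linf μ) * δ f := δ.leibniz f g
  rw [e]
  filter_upwards [Lp.coeFn_add ((f : Linf μ) * δ g) ((g : Linf μ) * δ f),
    Linf.coeFn_mul (f : Linf μ) (δ g), Linf.coeFn_mul (g : Linf μ) (δ f), coe_ae_eq_rep f,
    coe_ae_eq_rep g] with x h1 h2 h3 h4 h5
  rw [h1, Pi.add_apply, h2, h3, h4, h5]

end General

/-! ### A bounded rational function for localizing derivations. -/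

/-- A rational function with values in `[-ε, ε]` and derivative `1` at `0`. -/
def squash (ε t : ℝ) : ℝ := ε ^ 2 * t / (ε ^ 2 + t ^ 2)

theorem squash_mul {ε : ℝ} (hε : 0 < ε) (t : ℝ) :
    squash ε t * (ε ^ 2 + t * t) = ε ^ 2 * t := by
  rw [squash, ← sq]
  exact div_mul_cancel₀ _ (by positivity)

theorem abs_squash_le {ε : ℝ} (hε : 0 < ε) (t : ℝ) : |squash ε t| ≤ ε := by
  rw [squash, abs_div, abs_of_pos (by positivity : 0 < ε ^ 2 + t ^ 2), div_le_iff₀ (by positivity),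
    abs_mul, abs_of_pos (by positivity : 0 < ε ^ 2), ← sq_abs t]
  nlinarith [sq_nonneg (ε - |t|), abs_nonneg t, mul_nonneg hε.le (sq_nonneg (ε - |t|)),
    mul_nonneg (sq_nonneg ε) (abs_nonneg t)]

theorem lipschitzWith_squash {ε : ℝ} (hε : 0 < ε) : LipschitzWith 1 (squash ε) := by
  refine LipschitzWith.of_dist_le_mul fun s t => ?_
  have h1 : 0 < ε ^ 2 + s ^ 2 := by positivity
  have h2 : 0 < ε ^ 2 + t ^ 2 := by positivity
  have e : squash ε s - squash ε t =
      (s - t) * (ε ^ 2 * (ε ^ 2 - s * t) / ((ε ^ 2 + s ^ 2) * (ε ^ 2 + t ^ 2))) := by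
    rw [squash, squash]
    field_simp
    ring
  rw [Real.dist_eq, Real.dist_eq, e, abs_mul, NNReal.coe_one, one_mul]
  refine mul_le_of_le_one_right (abs_nonneg _) ?_
  rw [abs_div, abs_of_pos (mul_pos h1 h2), div_le_one (mul_pos h1 h2), abs_mul,
    abs_of_pos (by positivity : 0 < ε ^ 2)]
  have h3 : |ε ^ 2 - s * t| ≤ ε ^ 2 + s ^ 2 + t ^ 2 :=
    abs_le.2 ⟨by nlinarith [sq_nonneg (s - t), sq_nonneg (s + t), sq_nonneg ε],
      by nlinarith [sq_nonneg (s - t), sq_nonneg (s + t), sq_nonneg ε]⟩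
  nlinarith [mul_le_mul_of_nonneg_left h3 (sq_nonneg ε), mul_nonneg (sq_nonneg s) (sq_nonneg t)]

namespace HilbertCube

variable {p : ℝ≥0} [hp : Fact (1 ≤ p)] {a : lp (fun _ : ℕ => ℝ) p}

variable [ha : Fact (∀ n, 0 < a n)]

/-! ### The norm of a derivation is local -/

/-- The function `squash ε (f - r)` has Lipschitz number at most `lipNum f` and sup norm at most
`ε`, and its image under `δ` should agree with `δ f` where `f = r`. Since that set may be null, an
inequality valid for all rational `r` is proved off one null set and extended by continuity to `r =
rep f x`. -/
theorem ae_abs_le_add_of_bound {δ : Derivation ℝ (LipAlg (measure a)) (Linf (measure a))} {C : ℝ}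
    (hC : 0 ≤ C) (h : ∀ f, ‖δ f‖ ≤ C * lipNorm f) (f : LipAlg (measure a)) {ε : ℝ} (hε : 0 < ε) :
    ∀ᵐ x ∂measure a, |δ f x| ≤ C * (lipNum f + ε) := by
  have hL := lipNum_nonneg f
  have key (r : ℚ) : ∀ᵐ x ∂measure a,
      |ε ^ 2 - 2 * squash ε (rep f x - r) * (rep f x - r)| * |δ f x| ≤
        (ε ^ 2 + (rep f x - r) ^ 2) * (C * (lipNum f + ε)) := by
    obtain ⟨v, hv, hδv⟩ : ∃ v : LipAlg (measure a),
        rep v = (fun x => rep f x - r) ∧ δ v = δ f := by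
      refine ⟨f + algebraMap ℝ _ (-r : ℝ), ?_, by simp⟩
      rw [rep_add, rep_algebraMap]
      rfl
    have hU : LipschitzWith (lipNum f).toNNReal fun x => squash ε (rep f x - r) := by
      have h1 := (lipschitzWith_squash hε).comp
        ((lipschitzWith_rep f).sub (LipschitzWith.const (r : ℝ)))
      rwa [one_mul, add_zero] at h1
    let u := lipMk _ ⟨_, hU⟩
    have hu : ‖δ u‖ ≤ C * (lipNum f + ε) := (h u).trans <| mul_le_mul_of_nonneg_left
      (lipNorm_lipMk_le hU (by rw [Real.coe_toNNReal _ hL]; linarith) fun x =>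
        (abs_squash_le hε _).trans (by linarith)) hC
    -- Because `squash` is rational, `δ u` is obtained from this polynomial identity by the Leibniz
    -- rule, without a chain rule.
    have e : u * (algebraMap ℝ _ (ε ^ 2) + v * v) = (ε ^ 2) • v := by
      refine ext_rep (funext fun x => ?_)
      simp only [rep_mul, rep_add, rep_smul, rep_algebraMap, hv, Pi.mul_apply, Pi.add_apply,
        Pi.smul_apply, smul_eq_mul]
      simp only [u, rep_lipMk]
      exact squash_mul hε _
    have e1 : δ (algebraMap ℝ _ (ε ^ 2) + v * v) = δ (v * v) := by simp
    have e2 : δ (ε ^ 2 • v) = ε ^ 2 • δ f := by rw [Derivation.map_smul, hδv]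
    filter_upwards [ae_leibniz δ u (algebraMap ℝ _ (ε ^ 2) + v * v), ae_leibniz δ v v,
      Lp.coeFn_smul (ε ^ 2) (δ f), Linf.ae_le_norm (δ u)] with x h1 h2 h3 h4
    rw [e, e1, h2, e2, h3, hδv, rep_add, rep_mul, rep_algebraMap, hv] at h1
    simp only [u, rep_lipMk, Pi.add_apply, Pi.mul_apply, Pi.smul_apply, smul_eq_mul] at h1
    have h5 : (ε ^ 2 - 2 * squash ε (rep f x - r) * (rep f x - r)) * δ f x =
        (ε ^ 2 + (rep f x - r) ^ 2) * δ u x := by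
      linear_combination h1
    rw [← abs_mul, h5, abs_mul, abs_of_pos (by positivity : 0 < ε ^ 2 + (rep f x - r) ^ 2)]
    exact mul_le_mul_of_nonneg_left (h4.trans hu) (by positivity)
  filter_upwards [ae_all_iff.2 key] with x hx
  have hcl : IsClosed {r : ℝ | |ε ^ 2 - 2 * squash ε (rep f x - r) * (rep f x - r)| * |δ f x| ≤
      (ε ^ 2 + (rep f x - r) ^ 2) * (C * (lipNum f + ε))} := by
    have hs := (lipschitzWith_squash hε).continuous
    exact isClosed_le (by fun_prop) (by fun_prop)
  have h1 := hcl.closure_subset_iff.2 (Set.range_subset_iff.2 hx) (Rat.denseRange_cast (rep f x))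
  simp only [Set.mem_ofPred_eq, sub_self, mul_zero, sub_zero] at h1
  rw [abs_of_pos (by positivity : 0 < ε ^ 2)] at h1
  refine le_of_mul_le_mul_left (h1.trans_eq ?_) (by positivity : 0 < ε ^ 2)
  ring

/-- Let `ε` tend to `0`. Removing the sup norm is essential for the isometry, since the sup norm of
a linear function on the cube may exceed its Lipschitz number. -/
theorem norm_le_mul_lipNum {δ : Derivation ℝ (LipAlg (measure a)) (Linf (measure a))} {C : ℝ}
    (hC : 0 ≤ C) (h : ∀ f, ‖δ f‖ ≤ C * lipNorm f) (f : LipAlg (measure a)) :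
    ‖δ f‖ ≤ C * lipNum f := by
  have hL := lipNum_nonneg f
  have h1 (ε : ℝ) (hε : 0 < ε) : ‖δ f‖ ≤ C * (lipNum f + ε) :=
    Linf.norm_le_of_ae (by positivity) (ae_abs_le_add_of_bound hC h f hε)
  have ht : Tendsto (fun ε => C * (lipNum f + ε)) (𝓝[>] 0) (𝓝 (C * (lipNum f + 0))) :=
    ((continuous_const.mul (continuous_const.add continuous_id)).tendsto 0).mono_left
      nhdsWithin_le_nhds
  rw [add_zero] at ht
  exact ge_of_tendsto ht (eventually_nhdsWithin_of_forall h1)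

/-! ### Coordinates -/

/-- The `n`-th coordinate as an element of `Lip(M)`. -/
def coordLip (a : lp (fun _ : ℕ => ℝ) p) [Fact (∀ n, 0 < a n)] (n : ℕ) : LipAlg (measure a) :=
  lipMk (fun x => x.1 n) (exists_lipschitzWith_apply n)

theorem partialDeriv_apply (m n : ℕ) (x : HilbertCube a) :
    partialDeriv (fun x => x.1 m) n x = if n = m then 1 else 0 := by
  have hs (s : ℝ) : slice (fun x : HilbertCube a => x.1 m) n x s =
      (Function.update x.coord n (Set.projIcc 0 (a n) (ha.out n).le s) m : ℝ) := rfl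
  by_cases hnm : n = m
  · subst hnm
    rw [if_pos rfl, partialDeriv, derivWithin_congr (f := fun s => s) (fun s hs' => ?_)]
    · exact derivWithin_id' _ _ (uniqueDiffOn_Icc (ha.out n) _ (x.coord n).2)
    · rw [hs, Function.update_self, Set.projIcc_of_mem _ (x.coord n).2]
    · rw [hs, Function.update_self, Set.projIcc_of_mem _ hs']
  · have e : slice (fun x : HilbertCube a => x.1 m) n x = fun _ => x.1 m := by
      funext s
      rw [hs, Function.update_of_ne (Ne.symm hnm)]
      rfl
    rw [if_neg hnm, partialDeriv, e]
    simp

/-- Only the `m`-th partial derivative of the `m`-th coordinate survives. This gives injectivity and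
dictates the inverse map. -/
theorem combo_coordLip (g : lpSeq p (measure a)) (m : ℕ) : combo g (coordLip a m) = g.1 m := by
  refine Lp.ext ?_
  filter_upwards [ae_hasSum_combo g (coordLip a m),
    ae_all_iff.2 fun n => coe_pderiv n (coordLip a m)] with x h1 h2
  refine h1.unique ?_
  have e : ∀ n, g.1 n x * pderiv n (coordLip a m) x = if n = m then g.1 m x else 0 := fun n => by
    rw [h2, coordLip, rep_lipMk, partialDeriv_apply]
    split_ifs with h
    · rw [h, mul_one]
    · rw [mul_zero]
  simp only [e]
  exact hasSum_ite_eq m _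

theorem lipNum_sum_coordLip_le {q : ℝ} (hpq : (p : ℝ).HolderConjugate q) (S : Finset ℕ)
    (c : ℕ → ℝ) :
    lipNum (∑ n ∈ S, c n • coordLip a n) ≤ (∑ n ∈ S, |c n| ^ q) ^ (1 / q) := by
  have hq : 0 ≤ (∑ n ∈ S, |c n| ^ q) ^ (1 / q) :=
    Real.rpow_nonneg (Finset.sum_nonneg fun n _ => Real.rpow_nonneg (abs_nonneg _) _) _
  have hr : rep (∑ n ∈ S, c n • coordLip a n) = fun x => ∑ n ∈ S, c n * x.1 n := by
    rw [rep_sum]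
    funext x
    simp [rep_smul, coordLip]
  have hl : LipschitzWith ((∑ n ∈ S, |c n| ^ q) ^ (1 / q)).toNNReal
      (rep (∑ n ∈ S, c n • coordLip a n)) := by
    rw [hr]
    refine LipschitzWith.of_dist_le_mul fun x y => ?_
    rw [Real.coe_toNNReal _ hq, Real.dist_eq, ← Finset.sum_sub_distrib]
    calc |∑ n ∈ S, (c n * x.1 n - c n * y.1 n)|
        ≤ ∑ n ∈ S, |c n| * |x.1 n - y.1 n| := by
          refine (Finset.abs_sum_le_sum_abs _ _).trans_eq (Finset.sum_congr rfl fun n _ => ?_)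
          rw [← mul_sub, abs_mul]
      _ ≤ (∑ n ∈ S, |c n| ^ q) ^ (1 / q) * (∑ n ∈ S, |x.1 n - y.1 n| ^ (p : ℝ)) ^ (1 / (p : ℝ)) := by
          simpa only [abs_abs] using Real.inner_le_Lp_mul_Lq S (fun n => |c n|)
            (fun n => |x.1 n - y.1 n|) hpq.symm
      _ ≤ _ := mul_le_mul_of_nonneg_left (sum_rpow_le_dist x y S) hq
  have h := lipNum_le hl (coe_ae_eq_rep _)
  rwa [Real.coe_toNNReal _ hq] at h

/-- For fixed `c` this is the bound by the Lipschitz number of a linear function. One null set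
serves all `c`, because countably many dense `c` suffice: only finitely many entries occur, so both
sides are continuous in the product topology. -/
theorem ae_abs_sum_coordLip_le {δ : Derivation ℝ (LipAlg (measure a)) (Linf (measure a))} {C : ℝ}
    (hC : 0 ≤ C) (h : ∀ f, ‖δ f‖ ≤ C * lipNorm f) {q : ℝ} (hpq : (p : ℝ).HolderConjugate q)
    (S : Finset ℕ) : ∀ᵐ x ∂measure a, ∀ c : ℕ → ℝ,
      |∑ n ∈ S, c n * δ (coordLip a n) x| ≤ C * (∑ n ∈ S, |c n| ^ q) ^ (1 / q) := by
  have key (c : ℕ → ℝ) : ∀ᵐ x ∂measure a,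
      |∑ n ∈ S, c n * δ (coordLip a n) x| ≤ C * (∑ n ∈ S, |c n| ^ q) ^ (1 / q) := by
    have e : δ (∑ n ∈ S, c n • coordLip a n) = ∑ n ∈ S, c n • δ (coordLip a n) := by
      simp [map_sum]
    have h1 : ‖δ (∑ n ∈ S, c n • coordLip a n)‖ ≤ C * (∑ n ∈ S, |c n| ^ q) ^ (1 / q) :=
      (norm_le_mul_lipNum hC h _).trans
        (mul_le_mul_of_nonneg_left (lipNum_sum_coordLip_le hpq S c) hC)
    have h4 : ∀ᵐ x ∂measure a, (∑ n ∈ S, c n • δ (coordLip a n) : Linf (measure a)) x =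
        ∑ n ∈ S, c n * δ (coordLip a n) x := by
      filter_upwards [Lp.coeFn_finsetSum S fun n => c n • δ (coordLip a n),
        ae_all_iff.2 fun n => Lp.coeFn_smul (c n) (δ (coordLip a n))] with x h2 h3
      rw [h2, Finset.sum_apply]
      exact Finset.sum_congr rfl fun n _ => h3 n
    filter_upwards [h4, Linf.ae_le_norm (δ (∑ n ∈ S, c n • coordLip a n))] with x h5 h6
    rw [← h5, ← e]
    exact h6.trans h1
  filter_upwards [ae_all_iff.2 fun k => key (TopologicalSpace.denseSeq (ℕ → ℝ) k)] with x hx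
  intro c
  have hcl : IsClosed {c : ℕ → ℝ | |∑ n ∈ S, c n * δ (coordLip a n) x| ≤
      C * (∑ n ∈ S, |c n| ^ q) ^ (1 / q)} := by
    refine isClosed_le (by fun_prop) (continuous_const.mul ?_)
    refine Continuous.rpow_const (continuous_finsetSum _ fun n _ => ?_) fun _ =>
      Or.inr hpq.symm.one_div_nonneg
    exact Continuous.rpow_const (by fun_prop) fun _ => Or.inr hpq.symm.nonneg
  exact hcl.closure_subset_iff.2 (Set.range_subset_iff.2 hx)
    (TopologicalSpace.denseRange_denseSeq (ℕ → ℝ) c)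

theorem rpow_sum_le_of_forall_sum_mul_le {q : ℝ} (hpq : (p : ℝ).HolderConjugate q) {S : Finset ℕ}
    {d : ℕ → ℝ} {C : ℝ} (hC : 0 ≤ C)
    (h : ∀ c : ℕ → ℝ, |∑ n ∈ S, c n * d n| ≤ C * (∑ n ∈ S, |c n| ^ q) ^ (1 / q)) :
    (∑ n ∈ S, |d n| ^ (p : ℝ)) ^ (1 / (p : ℝ)) ≤ C := by
  -- `b` is the extremal vector in `l^p`–`l^q` duality for `|d|`; multiplying it by the signs of `d`
  -- gives the test vector `c`.
  obtain ⟨⟨b, hb, e⟩, -⟩ := NNReal.isGreatest_Lp S (fun n => ‖d n‖₊) hpq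
  have e' : ∑ n ∈ S, |d n| * (b n : ℝ) = (∑ n ∈ S, |d n| ^ (p : ℝ)) ^ (1 / (p : ℝ)) := by
    have := congrArg ((↑) : ℝ≥0 → ℝ) e
    push_cast at this
    simpa using this
  have hb' : ∑ n ∈ S, (b n : ℝ) ^ q ≤ 1 := by exact_mod_cast hb
  have h1 := h fun n => SignType.sign (d n) * b n
  have h2 : ∀ n, (SignType.sign (d n) * b n : ℝ) * d n = |d n| * b n := fun n => by
    rw [mul_right_comm, sign_mul_self]
  have h3 : ∀ n, |(SignType.sign (d n) * b n : ℝ)| ^ q ≤ (b n : ℝ) ^ q := fun n => by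
    refine Real.rpow_le_rpow (abs_nonneg _) ?_ hpq.symm.nonneg
    rw [abs_mul, NNReal.abs_eq]
    refine mul_le_of_le_one_left (b n).2 ?_
    rcases lt_trichotomy (d n) 0 with hd | hd | hd <;> simp [hd]
  simp only [h2] at h1
  rw [← e']
  refine (le_abs_self _).trans (h1.trans (mul_le_of_le_one_right hC ?_))
  exact Real.rpow_le_one (Finset.sum_nonneg fun n _ => Real.rpow_nonneg (abs_nonneg _) _)
    ((Finset.sum_le_sum fun n _ => h3 n).trans hb') hpq.symm.one_div_nonneg

theorem ae_sum_rpow_coordLip_le {δ : Derivation ℝ (LipAlg (measure a)) (Linf (measure a))} {C : ℝ}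
    (hp1 : 1 < p) (hC : 0 ≤ C) (h : ∀ f, ‖δ f‖ ≤ C * lipNorm f) (S : Finset ℕ) :
    ∀ᵐ x ∂measure a, ∑ n ∈ S, |δ (coordLip a n) x| ^ (p : ℝ) ≤ C ^ (p : ℝ) := by
  have hp0 := coe_pos (p := p)
  have hpq := Real.HolderConjugate.conjExponent (show (1 : ℝ) < p by exact_mod_cast hp1)
  filter_upwards [ae_abs_sum_coordLip_le hC h hpq S] with x hx
  have h1 := Real.rpow_le_rpow (by positivity) (rpow_sum_le_of_forall_sum_mul_le hpq hC hx) hp0.le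
  rwa [← Real.rpow_mul (by positivity), one_div_mul_cancel hp0.ne', Real.rpow_one] at h1

/-- The coefficients of a bounded derivation. -/
def coeffs (hp1 : 1 < p) {δ : Derivation ℝ (LipAlg (measure a)) (Linf (measure a))} {C : ℝ}
    (hC : 0 ≤ C) (h : ∀ f, ‖δ f‖ ≤ C * lipNorm f) : lpSeq p (measure a) :=
  ⟨fun n => δ (coordLip a n), C ^ (p : ℝ), fun N =>
    ae_sum_rpow_coordLip_le hp1 hC h (Finset.range N)⟩

theorem seqNorm_le_of_bound (hp1 : 1 < p) {g : lpSeq p (measure a)} {C : ℝ} (hC : 0 ≤ C)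
    (h : ∀ f, ‖combo g f‖ ≤ C * lipNorm f) : seqNorm g ≤ C := by
  have hp0 := coe_pos (p := p)
  refine seqNorm_le hC ?_
  have h1 (N : ℕ) := ae_sum_rpow_coordLip_le hp1 hC h (Finset.range N)
  simp only [combo_coordLip] at h1
  filter_upwards [ae_all_iff.2 h1] with x hx
  have h2 : ∑' n, |g.1 n x| ^ (p : ℝ) ≤ C ^ (p : ℝ) :=
    Real.tsum_le_of_sum_range_le (fun n => by positivity) hx
  have h3 := Real.rpow_le_rpow (tsum_nonneg fun n => by positivity) h2
    (by positivity : 0 ≤ 1 / (p : ℝ))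
  rwa [← Real.rpow_mul hC, mul_one_div_cancel hp0.ne', Real.rpow_one] at h3

theorem vfNorm_comboField (hp1 : 1 < p) (g : lpSeq p (measure a)) :
    vfNorm (comboField g) = seqNorm g := by
  have hmem : ∀ f, ‖combo g f‖ ≤ seqNorm g * lipNorm f := fun f => (norm_combo_le g f).trans
    (mul_le_mul_of_nonneg_left (le_max_left _ _) (seqNorm_nonneg g))
  exact le_antisymm (csInf_le ⟨0, fun _ h => h.1⟩ ⟨seqNorm_nonneg g, hmem⟩)
    (le_csInf ⟨_, seqNorm_nonneg g, hmem⟩ fun C hC => seqNorm_le_of_bound hp1 hC.1 hC.2)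

end HilbertCube

/-- On a finite measure space `u` itself lies in `L^1` and may be used as the test function. -/
theorem Linf.eq_zero_of_integral_mul {M : Type*} [MeasurableSpace M] {μ : Measure M}
    [IsFiniteMeasure μ] {u : Linf μ} (h : ∀ k : Lp ℝ 1 μ, ∫ x, u x * k x ∂μ = 0) : u = 0 := by
  have hu : Integrable u μ := (Lp.memLp u).integrable le_top
  have hi : Integrable (fun x => u x * u x) μ :=
    hu.bdd_mul (Lp.aestronglyMeasurable u) (Linf.ae_le_norm u)
  have h1 : ∫ x, u x * u x ∂μ = 0 := by
    rw [← h (hu.toL1 u)]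
    refine integral_congr_ae ?_
    filter_upwards [hu.coeFn_toL1] with x hx
    rw [hx]
  rw [integral_eq_zero_iff_of_nonneg (fun x => mul_self_nonneg _) hi] at h1
  refine Lp.ext ?_
  filter_upwards [h1, Lp.coeFn_zero ℝ ∞ μ] with x hx h0
  rw [h0]
  exact mul_self_eq_zero.1 hx

/-- These functions approximate `|t|` with a Lipschitz constant independent of `e`, as a weak* limit
argument requires. -/
theorem lipschitzWith_sqrt_sq_add (e : ℝ) : LipschitzWith 1 fun t : ℝ => √(t * t + e ^ 2) := by
  have key (s t : ℝ) : √(s * s + e ^ 2) ≤ √(t * t + e ^ 2) + |s - t| := by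
    refine Real.sqrt_le_iff.2 ⟨by positivity, ?_⟩
    have h1 : |t| ≤ √(t * t + e ^ 2) := Real.abs_le_sqrt (by nlinarith [sq_nonneg e])
    have h2 := Real.sq_sqrt (by nlinarith [sq_nonneg e, sq_nonneg t] : 0 ≤ t * t + e ^ 2)
    have h3 : t * (s - t) ≤ √(t * t + e ^ 2) * |s - t| :=
      (le_abs_self _).trans ((abs_mul _ _).trans_le
        (mul_le_mul_of_nonneg_right h1 (abs_nonneg _)))
    nlinarith [sq_abs (s - t)]
  refine LipschitzWith.of_dist_le_mul fun s t => ?_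
  rw [Real.dist_eq, Real.dist_eq, NNReal.coe_one, one_mul, abs_sub_le_iff]
  have h1 := key s t
  have h2 := key t s
  rw [abs_sub_comm] at h2
  constructor <;> linarith

namespace HilbertCube

variable {p : ℝ≥0} [hp : Fact (1 ≤ p)] {a : lp (fun _ : ℕ => ℝ) p}

variable [ha : Fact (∀ n, 0 < a n)]

/-! ### The kernel of a vector field -/

theorem tendsto_weakStarLip {f : ℕ → LipAlg (measure a)} {g : LipAlg (measure a)} {C : ℝ}
    (hb : ∀ j x, |rep (f j) x| ≤ C)
    (ht : ∀ x, Tendsto (fun j => rep (f j) x) atTop (𝓝 (rep g x))) :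
    Tendsto f atTop (@nhds _ (weakStarLip (measure a)) g) := by
  let _ : TopologicalSpace (LipAlg (measure a)) := weakStarLip (measure a)
  have hind : Topology.IsInducing fun (f : LipAlg (measure a)) (h : Lp ℝ 1 (measure a)) =>
      ∫ x, (f : Linf (measure a)) x * h x ∂measure a := ⟨induced_compose⟩
  refine hind.tendsto_nhds_iff.2 (tendsto_pi_nhds.2 fun h => ?_)
  have e (f : LipAlg (measure a)) : ∫ x, (f : Linf (measure a)) x * h x ∂measure a =
      ∫ x, rep f x * h x ∂measure a := by
    refine integral_congr_ae ?_
    filter_upwards [coe_ae_eq_rep f] with x hx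
    rw [hx]
  have hh : Integrable h (measure a) := L1.integrable_coeFn h
  simp only [Function.comp_def, e]
  refine tendsto_integral_of_dominated_convergence (fun x => C * |h x|)
    (fun j => (continuous_rep (f j)).aestronglyMeasurable.mul hh.aestronglyMeasurable)
    (hh.abs.const_mul C) (fun j => Eventually.of_forall fun x => ?_)
    (Eventually.of_forall fun x => (ht x).mul_const _)
  rw [norm_mul]
  exact mul_le_mul_of_nonneg_right (hb j x) (norm_nonneg _)

theorem lipNorm_smul_le {f : LipAlg (measure a)} {R : ℝ} (hR : 0 < R) (hf : lipNorm f ≤ R) :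
    lipNorm (R⁻¹ • f) ≤ 1 := by
  have h1 : (R⁻¹ * lipNum f) ≤ 1 := by
    rw [inv_mul_le_iff₀ hR, mul_one]
    exact (le_max_left _ _).trans hf
  refine max_le (le_trans ?_ h1) ?_
  · have hl : LipschitzWith (‖R⁻¹‖₊ * (lipNum f).toNNReal) (rep (R⁻¹ • f)) := by
      rw [rep_smul]
      exact (lipschitzWith_smul R⁻¹).comp (lipschitzWith_rep f)
    refine (lipNum_le hl (coe_ae_eq_rep _)).trans_eq ?_
    rw [NNReal.coe_mul, Real.coe_toNNReal _ (lipNum_nonneg f), coe_nnnorm, Real.norm_eq_abs,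
      abs_of_pos (inv_pos.2 hR)]
  · change ‖R⁻¹ • (f : Linf (measure a))‖ ≤ 1
    rw [norm_smul, Real.norm_eq_abs, abs_of_pos (inv_pos.2 hR), inv_mul_le_iff₀ hR, mul_one]
    exact (le_max_right _ _).trans hf

theorem lipNorm_le_of_rep {f : LipAlg (measure a)} {K : ℝ≥0} (hK : LipschitzWith K (rep f))
    {C : ℝ} (hC : ∀ x, |rep f x| ≤ C) : lipNorm f ≤ max (K : ℝ) C := by
  have h := lipNorm_lipMk_le hK (le_max_left (K : ℝ) C) fun x => (hC x).trans (le_max_right _ _)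
  rwa [show lipMk (rep f) ⟨K, hK⟩ = f from ext_rep (rep_lipMk _ _)] at h

/-- Bounded pointwise convergence implies weak* convergence by dominated convergence. Weak*
continuity of `δ` is given only on the unit ball, so everything is first divided by a common bound
`R` of the norms. -/
theorem vectorField_eq_zero_of_tendsto (δ : VectorField (measure a)) {f : ℕ → LipAlg (measure a)}
    {g : LipAlg (measure a)} {K : ℝ≥0} (hK : ∀ j, LipschitzWith K (rep (f j))) {C : ℝ}
    (hb : ∀ j x, |rep (f j) x| ≤ C)
    (ht : ∀ x, Tendsto (fun j => rep (f j) x) atTop (𝓝 (rep g x)))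
    (h0 : ∀ j, δ.1 (f j) = 0) : δ.1 g = 0 := by
  set R := max (max (K : ℝ) C) (max (lipNorm g) 1) with hRdef
  have hR : 0 < R := zero_lt_one.trans_le ((le_max_right _ _).trans (le_max_right _ _))
  have hfR (j : ℕ) : lipNorm (R⁻¹ • f j) ≤ 1 :=
    lipNorm_smul_le hR ((lipNorm_le_of_rep (hK j) (hb j)).trans (le_max_left _ _))
  have hgR : lipNorm (R⁻¹ • g) ≤ 1 :=
    lipNorm_smul_le hR ((le_max_left _ _).trans (le_max_right _ _))
  have ht' : Tendsto (fun j => R⁻¹ • f j) atTop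
      (@nhds _ (weakStarLip (measure a)) (R⁻¹ • g)) := by
    refine tendsto_weakStarLip (C := R⁻¹ * C) (fun j x => ?_) fun x => ?_
    · rw [rep_smul, Pi.smul_apply, smul_eq_mul, abs_mul, abs_of_pos (inv_pos.2 hR)]
      exact mul_le_mul_of_nonneg_left (hb j x) (inv_pos.2 hR).le
    · simp only [rep_smul, Pi.smul_apply, smul_eq_mul]
      exact (ht x).const_mul _
  have hz : δ.1 (R⁻¹ • g) = 0 := by
    refine Linf.eq_zero_of_integral_mul fun h => ?_
    let _ : TopologicalSpace (LipAlg (measure a)) := weakStarLip (measure a)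
    have hc := (weakStarContinuous_iff _).1 δ.2.2 h (R⁻¹ • g) hgR
    have hl := hc.tendsto.comp (tendsto_nhdsWithin_iff.2 ⟨ht', Eventually.of_forall hfR⟩)
    refine tendsto_nhds_unique hl ?_
    have e (j : ℕ) : ∫ x, δ.1 (R⁻¹ • f j) x * h x ∂measure a = 0 := by
      rw [Derivation.map_smul, h0, smul_zero]
      refine integral_eq_zero_of_ae ?_
      filter_upwards [Lp.coeFn_zero ℝ ∞ (measure a)] with x hx
      rw [hx, Pi.zero_apply, zero_mul]
    simp only [Function.comp_def, e]
    exact tendsto_const_nhds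
  rw [Derivation.map_smul] at hz
  exact (smul_eq_zero.1 hz).resolve_left (inv_pos.2 hR).ne'

/-- The Lipschitz functions whose class is annihilated by the vector field `δ`. -/
def Annihilates (δ : VectorField (measure a)) (F : HilbertCube a → ℝ) : Prop :=
  ∃ f : LipAlg (measure a), rep f = F ∧ δ.1 f = 0

namespace Annihilates

variable {δ : VectorField (measure a)} {F G : HilbertCube a → ℝ}

theorem const (r : ℝ) : Annihilates δ fun _ => r :=
  ⟨algebraMap ℝ _ r, rep_algebraMap r, Derivation.map_algebraMap _ r⟩

theorem add (hF : Annihilates δ F) (hG : Annihilates δ G) : Annihilates δ (F + G) := by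
  obtain ⟨f, rfl, hf⟩ := hF
  obtain ⟨g, rfl, hg⟩ := hG
  exact ⟨f + g, rep_add f g, by rw [map_add, hf, hg, add_zero]⟩

theorem smul (r : ℝ) (hF : Annihilates δ F) : Annihilates δ (r • F) := by
  obtain ⟨f, rfl, hf⟩ := hF
  exact ⟨r • f, rep_smul r f, by rw [Derivation.map_smul, hf, smul_zero]⟩

theorem sub (hF : Annihilates δ F) (hG : Annihilates δ G) : Annihilates δ (F - G) := by
  have h := hF.add (hG.smul (-1))
  rwa [neg_one_smul, ← sub_eq_add_neg] at h

theorem sum {ι : Type*} (S : Finset ι) {F : ι → HilbertCube a → ℝ}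
    (hF : ∀ i ∈ S, Annihilates δ (F i)) : Annihilates δ (∑ i ∈ S, F i) :=
  Finset.sum_induction F (Annihilates δ) (fun _ _ h h' => h.add h') (const 0) hF

/-- A common Lipschitz constant is enough: the values at one point converge and the cube is bounded,
so the functions are uniformly bounded. -/
theorem limit {F : ℕ → HilbertCube a → ℝ} {K : ℝ≥0} (hF : ∀ j, Annihilates δ (F j))
    (hK : ∀ j, LipschitzWith K (F j)) (ht : ∀ x, Tendsto (fun j => F j x) atTop (𝓝 (G x))) :
    Annihilates δ G := by
  choose f hf h0 using hF
  have hG : LipschitzWith K G := LipschitzWith.of_dist_le_mul fun x y =>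
    le_of_tendsto ((ht x).dist (ht y)) (Eventually.of_forall fun j => (hK j).dist_le_mul x y)
  let x₀ : HilbertCube a := ofPi fun n => ⟨0, le_rfl, (ha.out n).le⟩
  obtain ⟨B, hB⟩ := (ht x₀).abs.bddAbove_range
  obtain ⟨D, hD⟩ := isCompact_univ.exists_bound_of_continuousOn
    (f := fun x : HilbertCube a => dist x x₀) (by fun_prop)
  refine ⟨lipMk G ⟨K, hG⟩, rep_lipMk _ _, vectorField_eq_zero_of_tendsto δ (f := f) (K := K)
    (fun j => (hf j).symm ▸ hK j) (C := B + K * D) (fun j x => ?_) (fun x => ?_) h0⟩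
  · rw [hf]
    have h1 := (hK j).dist_le_mul x x₀
    have h2 := mul_le_mul_of_nonneg_left ((le_abs_self _).trans (hD x (Set.mem_univ x)))
      K.coe_nonneg
    have h3 : |F j x₀| ≤ B := hB ⟨j, rfl⟩
    rw [Real.dist_eq] at h1
    have h4 := abs_sub_abs_le_abs_sub (F j x) (F j x₀)
    linarith
  · simp only [hf, rep_lipMk]
    exact ht x

/-- For `u = √(f² + e²)` the Leibniz rule applied to `u² = f² + e²` gives `2 u δ u = 0`, and `u` is
positive everywhere, so `δ u = 0`. Then `e` tends to `0`. -/
theorem abs (hF : Annihilates δ F) : Annihilates δ fun x => |F x| := by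
  obtain ⟨f, rfl, hf⟩ := hF
  have hl (j : ℕ) : LipschitzWith (lipNum f).toNNReal
      fun x => √(rep f x * rep f x + (1 / ((j : ℝ) + 1)) ^ 2) := by
    have h := (lipschitzWith_sqrt_sq_add (1 / ((j : ℝ) + 1))).comp (lipschitzWith_rep f)
    rwa [one_mul] at h
  refine limit (fun j => ?_) hl fun x => ?_
  · refine ⟨lipMk _ ⟨_, hl j⟩, rep_lipMk _ _, ?_⟩
    set u := lipMk _ ⟨_, hl j⟩ with hu
    have hpos (x : HilbertCube a) : 0 < rep f x * rep f x + (1 / ((j : ℝ) + 1)) ^ 2 :=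
      add_pos_of_nonneg_of_pos (mul_self_nonneg _) (by positivity)
    have e : u * u = f * f + algebraMap ℝ _ ((1 / ((j : ℝ) + 1)) ^ 2) := by
      refine ext_rep (funext fun x => ?_)
      rw [rep_mul, rep_add, rep_mul, rep_algebraMap, hu, rep_lipMk]
      exact Real.mul_self_sqrt (hpos x).le
    have h0 : δ.1 (u * u) = 0 := by
      rw [e, map_add, Derivation.leibniz, hf, smul_zero, Derivation.map_algebraMap, add_zero,
        add_zero]
    refine Lp.ext ?_
    filter_upwards [ae_leibniz δ.1 u u, Lp.coeFn_zero ℝ ∞ (measure a)] with x h1 h2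
    rw [h0, h2, hu, rep_lipMk, ← hu, ← two_mul, Pi.zero_apply] at h1
    rw [h2]
    have h3 := (Real.sqrt_pos.2 (hpos x)).ne'
    exact ((mul_eq_zero.1 ((mul_eq_zero.1 h1.symm).resolve_left two_ne_zero)).resolve_left h3)
  · have h1 : Tendsto (fun j : ℕ => √(rep f x * rep f x + (1 / ((j : ℝ) + 1)) ^ 2)) atTop
        (𝓝 (√(rep f x * rep f x + 0 ^ 2))) :=
      ((tendsto_one_div_add_atTop_nhds_zero_nat.pow 2).const_add _).sqrt
    simpa [Real.sqrt_mul_self_eq_abs] using h1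

theorem inf (hF : Annihilates δ F) (hG : Annihilates δ G) : Annihilates δ (F ⊓ G) := by
  have h := ((hF.add hG).sub (hF.sub hG).abs).smul (1 / 2)
  refine (congrArg (Annihilates δ) (funext fun x => ?_)).mp h
  change 1 / 2 * (F x + G x - |F x - G x|) = min (F x) (G x)
  rcases le_total (F x) (G x) with hle | hle
  · rw [min_eq_left hle, abs_of_nonpos (sub_nonpos.2 hle)]
    ring
  · rw [min_eq_right hle, abs_of_nonneg (sub_nonneg.2 hle)]
    ring

end Annihilates

/-! ### Lipschitz functions of finitely many coordinates and their limits. -/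

/-- The point of the cube whose coordinates from the `N`-th on are replaced by `0`. -/
def trunc (N : ℕ) (x : HilbertCube a) : HilbertCube a :=
  patch (Finset.range N) (ofPi fun n => ⟨0, le_rfl, (ha.out n).le⟩) x

theorem trunc_apply_of_lt {N n : ℕ} (h : n < N) (x : HilbertCube a) :
    (trunc N x).coord n = x.coord n := by
  simp [trunc, patch, Finset.piecewise, h]

theorem trunc_apply_of_le {N n : ℕ} (h : N ≤ n) (x : HilbertCube a) :
    ((trunc N x).coord n : ℝ) = 0 := by
  simp only [trunc, patch, coord_ofPi, Finset.piecewise, Finset.mem_range, not_lt.2 h, if_false]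

theorem dist_trunc (N : ℕ) (x y : HilbertCube a) : dist (trunc N x) (trunc N y) =
    (∑ n ∈ Finset.range N, |x.1 n - y.1 n| ^ (p : ℝ)) ^ (1 / (p : ℝ)) := by
  rw [dist_eq_sum (S := Finset.range N) fun n hn => ?_]
  · congr 1
    refine Finset.sum_congr rfl fun n hn => ?_
    rw [← coe_coord, ← coe_coord, trunc_apply_of_lt (Finset.mem_range.1 hn),
      trunc_apply_of_lt (Finset.mem_range.1 hn), coe_coord, coe_coord]
  · rw [Finset.mem_range, not_lt] at hn
    rw [← coe_coord, ← coe_coord, trunc_apply_of_le hn, trunc_apply_of_le hn]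

theorem lipschitzWith_trunc (N : ℕ) : LipschitzWith 1 (trunc (a := a) N) :=
  LipschitzWith.of_dist_le_mul fun x y => by
    rw [dist_trunc, NNReal.coe_one, one_mul]
    exact sum_rpow_le_dist x y _

/-- The sum on the right is built from coordinates by absolute values, so it stays inside the kernel
of a field that annihilates the coordinates. The size of the constant does not matter. -/
theorem dist_trunc_le (N : ℕ) (x y : HilbertCube a) : dist (trunc N x) (trunc N y) ≤
    (N : ℝ) ^ (1 / (p : ℝ)) * ∑ n ∈ Finset.range N, |x.1 n - y.1 n| := by
  have hp0 := coe_pos (p := p)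
  set D := ∑ n ∈ Finset.range N, |x.1 n - y.1 n| with hD
  have hD0 : 0 ≤ D := Finset.sum_nonneg fun n _ => abs_nonneg _
  have h : ∑ n ∈ Finset.range N, |x.1 n - y.1 n| ^ (p : ℝ) ≤ N * D ^ (p : ℝ) := by
    refine (Finset.sum_le_card_nsmul _ _ (D ^ (p : ℝ)) fun n hn => ?_).trans_eq (by simp)
    exact Real.rpow_le_rpow (abs_nonneg _) (Finset.single_le_sum
      (f := fun n => |x.1 n - y.1 n|) (fun n _ => abs_nonneg _) hn) hp0.le
  rw [dist_trunc]
  refine (Real.rpow_le_rpow (by positivity) h (by positivity)).trans_eq ?_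
  rw [Real.mul_rpow (by positivity) (by positivity), ← Real.rpow_mul hD0,
    mul_one_div_cancel hp0.ne', Real.rpow_one]

theorem tendsto_trunc (x : HilbertCube a) : Tendsto (fun N => trunc N x) atTop (𝓝 x) := by
  have h : Tendsto (fun N => (trunc N x).coord) atTop (𝓝 x.coord) := by
    refine tendsto_pi_nhds.2 fun n => tendsto_const_nhds.congr' ?_
    filter_upwards [eventually_gt_atTop n] with N hN using (trunc_apply_of_lt hN x).symm
  exact (continuous_ofPi.tendsto x.coord).comp h

/-- A vector field that annihilates the coordinates annihilates every Lipschitz function of finitely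
many coordinates: such a function is the limit of minima of functions `x ↦ c + D ∑ |x n - y n|`. -/
theorem annihilates_comp_trunc {δ : VectorField (measure a)} (h0 : ∀ n, δ.1 (coordLip a n) = 0)
    {F : HilbertCube a → ℝ} {K : ℝ≥0} (hF : LipschitzWith K F) (N : ℕ) :
    Annihilates δ fun x => F (trunc N x) := by
  have : Nonempty (HilbertCube a) := ⟨ofPi fun n => ⟨0, le_rfl, (ha.out n).le⟩⟩
  set D : ℝ := K * (N : ℝ) ^ (1 / (p : ℝ)) with hDdef
  have hD : 0 ≤ D := by positivity
  let s (y x : HilbertCube a) : ℝ := D * ∑ n ∈ Finset.range N, |x.1 n - y.1 n|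
  have hs (x y : HilbertCube a) : |F (trunc N x) - F (trunc N y)| ≤ s y x := by
    refine (hF.dist_le_mul _ _).trans ((mul_le_mul_of_nonneg_left (dist_trunc_le N x y) K.2).trans_eq
      (mul_assoc _ _ _).symm)
  let y : ℕ → HilbertCube a := TopologicalSpace.denseSeq _
  -- As in McShane's extension formula, each `h k` lies above `F ∘ trunc N` and meets it at `y k`.
  let h (k : ℕ) (x : HilbertCube a) : ℝ := F (trunc N (y k)) + s (y k) x
  have hker (k : ℕ) : Annihilates δ (h k) := by
    have hsum := (Annihilates.sum (δ := δ) (Finset.range N)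
      (F := fun n x => |x.1 n - (y k).1 n|) fun n _ =>
        (Annihilates.sub ⟨coordLip a n, rep_lipMk _ _, h0 n⟩ (Annihilates.const _)).abs).smul D
    refine (congrArg (Annihilates δ) (funext fun x => ?_)).mp
      ((Annihilates.const (F (trunc N (y k)))).add hsum)
    simp [h, s]
  -- The constant does not depend on `k`, so it passes to finite minima and allows the limit.
  have hlip (k : ℕ) : LipschitzWith (D * N).toNNReal (h k) := by
    refine LipschitzWith.of_dist_le_mul fun x z => ?_
    have e : h k x - h k z = D * ∑ n ∈ Finset.range N,
        (|x.1 n - (y k).1 n| - |z.1 n - (y k).1 n|) := by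
      rw [Finset.sum_sub_distrib, mul_sub]
      exact add_sub_add_left_eq_sub _ _ _
    rw [Real.coe_toNNReal _ (by positivity), Real.dist_eq, e, abs_mul, abs_of_nonneg hD, mul_assoc D N]
    refine mul_le_mul_of_nonneg_left ((Finset.abs_sum_le_sum_abs _ _).trans ?_) hD
    refine (Finset.sum_le_card_nsmul (Finset.range N) _ (dist x z) fun n _ => ?_).trans_eq (by simp)
    refine (abs_abs_sub_abs_le_abs_sub _ _).trans ?_
    rw [sub_sub_sub_cancel_right]
    exact abs_sub_le_dist x z n
  let H (m : ℕ) : HilbertCube a → ℝ :=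
    (Finset.range (m + 1)).inf' Finset.nonempty_range_add_one h
  have hH (m : ℕ) : Annihilates δ (H m) ∧ LipschitzWith (D * N).toNNReal (H m) :=
    Finset.inf'_induction _ h (p := fun G => Annihilates δ G ∧ LipschitzWith (D * N).toNNReal G)
      (fun _ h1 _ h2 => ⟨h1.1.inf h2.1, max_self (D * N).toNNReal ▸ h1.2.min h2.2⟩)
      fun k _ => ⟨hker k, hlip k⟩
  refine Annihilates.limit (fun m => (hH m).1) (fun m => (hH m).2) fun x => ?_
  have hlow (m : ℕ) : F (trunc N x) ≤ H m x := by
    simp only [H, Finset.inf'_apply]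
    refine Finset.le_inf' _ _ fun k _ => ?_
    have := (abs_le.1 (hs x (y k))).2
    simp only [h]
    linarith
  refine tendsto_order.2 ⟨fun b hb => Eventually.of_forall fun m => hb.trans_le (hlow m),
    fun b hb => ?_⟩
  -- This open set contains `x`, where `s x x = 0`, and hence some `y k`; from then on the minima at
  -- `x` stay below `b`.
  have hopen : IsOpen {z : HilbertCube a | F (trunc N z) + s z x < b} := by
    have h1 := hF.continuous.comp (lipschitzWith_trunc (a := a) N).continuous
    have h2 (n : ℕ) := continuous_apply (a := a) n
    have h3 : Continuous fun z => s z x := by fun_prop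
    exact isOpen_lt (h1.add h3) continuous_const
  obtain ⟨k, hk⟩ := (TopologicalSpace.denseRange_denseSeq (HilbertCube a)).exists_mem_open hopen
    ⟨x, by simpa [s] using hb⟩
  filter_upwards [eventually_ge_atTop k] with m hm
  refine lt_of_le_of_lt ?_ hk
  simp only [H, Finset.inf'_apply]
  exact Finset.inf'_le (fun k => h k x) (Finset.mem_range.2 (Nat.lt_succ_of_le hm))

/-- Truncation is `1`-Lipschitz and tends to the identity pointwise, so `f ∘ trunc N` converges to
`f` with the Lipschitz constant of `f`. -/
theorem vectorField_eq_zero {δ : VectorField (measure a)} (h0 : ∀ n, δ.1 (coordLip a n) = 0) :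
    δ = 0 := by
  refine Subtype.ext (Derivation.ext fun f => ?_)
  have hL := lipschitzWith_rep f
  obtain ⟨f', hf', h'⟩ := Annihilates.limit (G := rep f)
    (fun N => annihilates_comp_trunc h0 hL N)
    (fun N => mul_one (lipNum f).toNNReal ▸ hL.comp (lipschitzWith_trunc N))
    (fun x => (hL.continuous.tendsto x).comp (tendsto_trunc x))
  rw [← ext_rep hf', h']
  rfl

/-! ### The isomorphism -/

/-- The isomorphism of `l^p(L^∞(M))` with the module of vector fields. -/
def fieldEquiv (a : lp (fun _ : ℕ => ℝ) p) [Fact (∀ n, 0 < a n)] (hp1 : 1 < p) :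
    lpSeq p (measure a) ≃ₗ[Linf (measure a)] VectorField (measure a) :=
  LinearEquiv.ofBijective
    { toFun := comboField
      map_add' := fun g g' => Subtype.ext (by exact combo_add g g')
      map_smul' := fun u g => Subtype.ext (by exact combo_smul u g) } <| by
    refine ⟨fun g g' h => Subtype.ext (funext fun n => ?_), fun δ => ?_⟩
    · rw [← combo_coordLip g, ← combo_coordLip g']
      exact congrArg (fun δ : VectorField (measure a) => δ.1 (coordLip a n)) h
    · obtain ⟨C, hC⟩ := δ.2.1
      -- The bound in `VectorField` comes without a sign, whereas the coefficient estimates need a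
      -- nonnegative constant.
      have hC' (f) : ‖δ.1 f‖ ≤ max C 0 * lipNorm f :=
        (hC f).trans (mul_le_mul_of_nonneg_right (le_max_left _ _) (lipNorm_nonneg f))
      refine ⟨coeffs hp1 (le_max_right C 0) hC', ?_⟩
      have h0 : δ - comboField (coeffs hp1 (le_max_right C 0) hC') = 0 :=
        vectorField_eq_zero fun n => ?_
      · exact (sub_eq_zero.1 h0).symm
      change δ.1 (coordLip a n) - combo _ (coordLip a n) = 0
      rw [combo_coordLip]
      exact sub_self _

end HilbertCube

end Weaver

end

theorem theorem44 (p : ℝ≥0) [Fact (1 ≤ p)] (hp : 1 < p)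
    (a : lp (fun _ : ℕ => ℝ) p) (ha : ∀ n, 0 < a n) :
    (∀ F : Weaver.HilbertCube a → ℝ, (∃ K, LipschitzWith K F) → ∀ n,
      (∀ᵐ x ∂(Weaver.HilbertCube.measure a), DifferentiableWithinAt ℝ
        (Weaver.HilbertCube.slice F n x) (Set.Icc 0 (a n)) (x.coord n)) ∧
      MemLp (Weaver.HilbertCube.partialDeriv F n) ∞ (Weaver.HilbertCube.measure a)) ∧
    ∃ Φ : Weaver.lpSeq p (Weaver.HilbertCube.measure a)
        ≃ₗ[Weaver.Linf (Weaver.HilbertCube.measure a)]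
        Weaver.VectorField (Weaver.HilbertCube.measure a),
      (∀ g, Weaver.vfNorm (Φ g) = Weaver.seqNorm g) ∧
      ∀ (g : Weaver.lpSeq p (Weaver.HilbertCube.measure a))
        (f : Weaver.LipAlg (Weaver.HilbertCube.measure a)) (F : Weaver.HilbertCube a → ℝ),
        (∃ K, LipschitzWith K F) → f.1 =ᵐ[Weaver.HilbertCube.measure a] F →
        (∀ᵐ x ∂(Weaver.HilbertCube.measure a),
          HasSum (fun n => g.1 n x * Weaver.HilbertCube.partialDeriv F n x)
            ((Φ g).1 f x)) ∧
        ∀ h : Lp ℝ 1 (Weaver.HilbertCube.measure a),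
          HasSum (fun n => ∫ x, g.1 n x * Weaver.HilbertCube.partialDeriv F n x * h x
              ∂(Weaver.HilbertCube.measure a))
            (∫ x, (Φ g).1 f x * h x ∂(Weaver.HilbertCube.measure a)) := by
  have hfact : Fact (∀ n, 0 < a n) := ⟨ha⟩
  refine ⟨fun F ⟨K, hF⟩ n => ⟨?_, Weaver.HilbertCube.memLp_partialDeriv hF n⟩,
    Weaver.HilbertCube.fieldEquiv a hp, Weaver.HilbertCube.vfNorm_comboField hp,
    fun g f F hF hf => ?_⟩
  · filter_upwards [Weaver.HilbertCube.ae_gradient hF] with x hx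
    exact (hx.1 n).differentiableWithinAt
  -- By full support the given representative is `rep f` itself, so the classes `pderiv n f` are
  -- those of its partial derivatives.
  · rw [Weaver.eq_rep hF hf]
    have he := ae_all_iff.2 fun n => Weaver.HilbertCube.coe_pderiv n f
    refine ⟨?_, fun h => ?_⟩
    · filter_upwards [Weaver.HilbertCube.ae_hasSum_combo g f, he] with x h1 h2
      simp only [← h2]
      exact h1
    · refine (Weaver.HilbertCube.hasSum_integral_combo g f h).congr_fun fun n =>
        integral_congr_ae ?_
      filter_upwards [he] with x h2
      rw [h2 n]
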